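/- Let $\mathcal Z=\sum_{i=1}^N\delta_{\xi_i}$ be a point process on $\mathbb R$, where $N$ is a random variable with values in $\{0,1,2,\dots\}$, and let $S$ be the branching random walk with reproduction $\mathcal Z$: one particle starts at $0$; each particle of generation $n$ produces, independently of all the others, the particles of generation $n+1$ that are its children, and their positions relative to their parent are given by an independent copy of $\mathcal Z$. Write $\mathbb T$ for the tree of particles, $|v|$ for the generation and $S_v$ for the position of $v\in\mathbb T$. Put $$\nu(t)=\log\mathbb E\Big[\sum_{i=1}^N e^{t\xi_i}\Big],\qquad \nu'(t)=e^{-\nu(t)}\,\mathbb E\Big[\sum_{i=1}^N\xi_i e^{t\xi_i}\Big],\qquad \theta_0=\inf\{t>0:\ \nu(t)=t\,\nu'(t)\},$$ where the infimum is over those $t$ at which $\nu(t)$ and $\nu'(t)$ are finite, and $\inf\emptyset=+\infty$. Assume that $\mathbb P(N=0)=0$, that $\nu$ is finite on an open interval containing $0$, and that $0<\theta_0<\infty$. Let $\mu$ be a probability measure on $(0,\infty)$ and $\theta>0$. Let $(Y_v)_{v\in\mathbb T}$ be i.i.d. with law $\mu$ and $(E_v)_{v\in\mathbb T}$ i.i.d.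 exponential with parameter $1$, where $(Y_v)$, $(E_v)$ and $S$ are independent, and let $$R_n^*=R_n^*(\theta)=\sup_{|v|=n}\Big(S_v+\frac1\theta\log\frac{Y_v}{E_v}\Big).$$ If $\theta\ge\theta_0$ and $\int x^r\,\mu(dx)<\infty$ for every $r$ with $0<r<\theta_0/\theta$, then $$\frac{R_n^*}{n}\longrightarrow\frac{\nu(\theta_0)}{\theta_0}\qquad\text{almost surely as } n\to\infty .$$ -/

import Mathlib

open MeasureTheory ProbabilityTheory Filter Topology

noncomputable section

namespace PerturbedBRW

/-- A realisation `z = (N, ξ)` of the reproduction point process `∑_{k < N} δ_{ξ k}` on the line: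
`z.1` is the (finite) number of children and `z.2 k`, for `k < z.1`, is the displacement of the
`k`-th child from its parent. The values `z.2 k` with `k ≥ z.1` play no role. -/
abbrev Offspring : Type := ℕ × (ℕ → ℝ)

/-- `∑_{k < N} e^{t ξ_k}`. -/
def expSum (t : ℝ) (z : Offspring) : ℝ :=
  ∑ k ∈ Finset.range z.1, Real.exp (t * z.2 k)

/-- `∑_{k < N} ξ_k e^{t ξ_k}`. -/
def weightedExpSum (t : ℝ) (z : Offspring) : ℝ :=
  ∑ k ∈ Finset.range z.1, z.2 k * Real.exp (t * z.2 k)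

/-- `ν(t) < ∞` for the log-Laplace transform `ν` of the reproduction law `ρ`. -/
def LaplaceFinite (ρ : Measure Offspring) (t : ℝ) : Prop :=
  Integrable (expSum t) ρ

/-- The log-Laplace transform `ν(t) = log 𝔼[∑_{k < N} e^{t ξ_k}]`;
meaningful when `LaplaceFinite ρ t`. -/
def nu (ρ : Measure Offspring) (t : ℝ) : ℝ :=
  Real.log (∫ z, expSum t z ∂ρ)

/-- `ν'(t) = e^{-ν(t)} 𝔼[∑_{k < N} ξ_k e^{t ξ_k}]`; meaningful when `LaplaceFinite ρ t` and
`weightedExpSum t` is integrable. -/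
def nuPrime (ρ : Measure Offspring) (t : ℝ) : ℝ :=
  Real.exp (-nu ρ t) * ∫ z, weightedExpSum t z ∂ρ

/-- The set of `t > 0` with `ν(t) = t ν'(t)`, both sides being well defined and finite. -/
def criticalSet (ρ : Measure Offspring) : Set ℝ :=
  {t | 0 < t ∧ LaplaceFinite ρ t ∧ Integrable (weightedExpSum t) ρ ∧ nu ρ t = t * nuPrime ρ t}

/-- The critical parameter `θ₀ = inf {t > 0 : ν(t) = t ν'(t)}`, equal to `+∞` if there is no
such `t`. -/
def criticalParam (ρ : Measure Offspring) : EReal :=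
  sInf ((fun t : ℝ => (t : EReal)) '' criticalSet ρ)

/-- Potential particles are labelled by words over `ℕ`: `[]` is the root and `k :: u` is the
`k`-th child of `u`, so that the generation of a particle is the length of its word. Given the
reproductions `z u` of all labels, `InTree z v` says that `v` is born. -/
def InTree (z : List ℕ → Offspring) : List ℕ → Prop
  | [] => True
  | k :: u => InTree z u ∧ k < (z u).1

/-- The position `S_v` of the particle `v`. -/
def position (z : List ℕ → Offspring) : List ℕ → ℝ
  | [] => 0
  | k :: u => position z u + (z u).2 k

/-- The particles of the `n`-th generation. -/
def generation (z : List ℕ → Offspring) (n : ℕ) : Set (List ℕ) :=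
  {v | v.length = n ∧ InTree z v}

/-- The perturbed position `S*_v = S_v + (1/θ) log (Y_v / E_v)`. -/
def perturbedPosition (θ : ℝ) (z : List ℕ → Offspring) (y e : List ℕ → ℝ) (v : List ℕ) : ℝ :=
  position z v + 1 / θ * Real.log (y v / e v)

/-- The rightmost perturbed position `R*_n(θ) = sup_{|v| = n} S*_v`. (Every generation is a
finite set, and it is non-empty when every particle has a child.) -/
def rightmost (θ : ℝ) (z : List ℕ → Offspring) (y e : List ℕ → ℝ) (n : ℕ) : ℝ :=
  sSup (perturbedPosition θ z y e '' generation z n)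

/-- The random input of the perturbed branching random walk with reproduction law `ρ` and
perturbation law `μ`: the reproductions `Z u` are i.i.d. with law `ρ`, the variables `Y v` are
i.i.d. with law `μ`, the variables `E v` are i.i.d. with law `Exp(1)`, and the three families
are independent of one another. -/
structure IsInput {Ω : Type*} [MeasurableSpace Ω] (P : Measure Ω) (ρ : Measure Offspring)
    (μ : Measure ℝ) (Z : List ℕ → Ω → Offspring) (Y E : List ℕ → Ω → ℝ) : Prop where
  measurable_Z : ∀ u, Measurable (Z u)
  measurable_Y : ∀ v, Measurable (Y v)
  measurable_E : ∀ v, Measurable (E v)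
  law_Z : ∀ u, P.map (Z u) = ρ
  law_Y : ∀ v, P.map (Y v) = μ
  law_E : ∀ v, P.map (E v) = expMeasure 1
  indep_Z : iIndepFun Z P
  indep_Y : iIndepFun Y P
  indep_E : iIndepFun E P
  indep_Y_E : IndepFun (fun ω v => Y v ω) (fun ω v => E v ω) P
  indep_Z_YE : IndepFun (fun ω u => Z u ω) (fun ω => (fun v => Y v ω, fun v => E v ω)) P

end PerturbedBRW

end

/-!
Everything is reduced to the functions `F_n(x) = P(all perturbed positions in generation n are
less than x)`. Conditioning on the children of the root gives `F_{n+1} = T F_n`, where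
`T f (y) = 𝔼[∏_{k < N} f(y - ξ_k)]` is the branching operator (`branch`, `rightmostCDF_succ`). With
`v = ν(θ₀) / θ₀`, both `∑ (1 - F_n(n x))` for `x > v` and `∑ F_n(n x)` for `x < v` are finite
(`IsSubCDF.summable_deviations`), and the Borel–Cantelli lemma concludes. No assumption on `Y` near
`0` is needed, since the perturbation enters only through the initial function `F_0`.

*Upper bound.* For `t < θ₀ ≤ θ`, the tail of the perturbation is `O(e^{-t x})`, and the union bound
gives `1 - F_n(x) ≤ C m(t)^n e^{-t x}` with `m = e^ν`
(`IsSubCDF.one_sub_iterate_branch_le`). Then let `t ↑ θ₀`.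

*Lower bound.* For `0 < t < θ₀` one has `ν(t) > t ν'(t)` (`growthRate_pos`), and `ν'(t) → v` as
`t ↑ θ₀`, because the infimum defining `θ₀` is attained. If `a < ν'(t)`, the expected number of
particles of generation `K` beyond `K a` exceeds `1` for some `K`
(`exists_one_lt_expectedCount`). This number is the derivative at `γ = 0` of
`1 - T^K(1 - γ 1_{(-∞, 0]})` at `K a`, hence a small `γ > 0` with `1 - F_n(n a) ≥ γ` is reproduced
`K` generations later, and therefore `F_n(n a) ≤ 1 - γ` for all `n`
(`IsSubCDF.exists_iterate_branch_le`). Finally, a small fraction of the `n` generations is used to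
produce many independent starting points, none of them far to the left, which makes `F_n(n x)`
exponentially small for `x < a` (`IsSubCDF.iterate_branch_le_pow_add`). This needs `P(N > 1) > 0`,
which follows from `0 < θ₀ < ∞` by the equality case of Jensen's inequality (`not_ae_eq_one`).
-/

namespace PerturbedBRW

/-! ### The reproduction sums and their Laplace transform -/

section

theorem measurable_sum_range_offspring {f : ℝ → ℝ} (hf : Measurable f) :
    Measurable fun z : Offspring => ∑ k ∈ Finset.range z.1, f (z.2 k) := by
  refine measurable_from_prod_countable_right fun n => ?_
  exact Finset.measurable_sum (Finset.range n) fun k _ => hf.comp (measurable_pi_apply k)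

theorem measurable_prod_range_offspring {f : ℝ → ℝ} (hf : Measurable f) :
    Measurable fun z : Offspring => ∏ k ∈ Finset.range z.1, f (z.2 k) := by
  refine measurable_from_prod_countable_right fun n => ?_
  exact Finset.measurable_prod (Finset.range n) fun k _ => hf.comp (measurable_pi_apply k)

theorem measurable_expSum (t : ℝ) : Measurable (expSum t) :=
  measurable_sum_range_offspring (f := fun x => Real.exp (t * x)) (by fun_prop)

theorem measurable_weightedExpSum (t : ℝ) : Measurable (weightedExpSum t) :=
  measurable_sum_range_offspring (f := fun x => x * Real.exp (t * x)) (by fun_prop)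

theorem expSum_nonneg (t : ℝ) (z : Offspring) : 0 ≤ expSum t z :=
  Finset.sum_nonneg fun _ _ => (Real.exp_pos _).le

theorem expSum_zero (z : Offspring) : expSum 0 z = z.1 := by simp [expSum]

theorem expSum_le_add {s T : ℝ} (hs : 0 ≤ s) (hsT : s ≤ T) (z : Offspring) :
    expSum s z ≤ expSum 0 z + expSum T z := by
  simp only [expSum, ← Finset.sum_add_distrib]
  refine Finset.sum_le_sum fun k _ => ?_
  rcases le_total 0 (z.2 k) with h | h
  · have : Real.exp (s * z.2 k) ≤ Real.exp (T * z.2 k) := by gcongr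
    have := Real.exp_pos (0 * z.2 k)
    linarith
  · have : Real.exp (s * z.2 k) ≤ Real.exp (0 * z.2 k) := by
      rw [Real.exp_le_exp]; nlinarith
    have := Real.exp_pos (T * z.2 k)
    linarith

theorem neg_mul_exp_le {a x : ℝ} (ha : 0 < a) : -x * Real.exp (a * x) ≤ 1 / a := by
  rw [le_div_iff₀ ha]
  have h1 : -(a * x) + 1 ≤ Real.exp (-(a * x)) := Real.add_one_le_exp _
  have h2 : Real.exp (-(a * x)) * Real.exp (a * x) = 1 := by rw [← Real.exp_add]; simp
  nlinarith [Real.exp_pos (a * x)]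

/-- Only the positive displacements can make `|x| e^{s x}` large; they are controlled by the
largest exponent `T`, and the negative ones by the smallest exponent `α`. -/
theorem abs_mul_exp_le {α s T x : ℝ} (hα : 0 < α) (hs : α ≤ s) (hsT : s ≤ T) :
    |x| * Real.exp (s * x) ≤ x * Real.exp (T * x) + (1 / α + 1 / T) := by
  have hT : 0 < T := by linarith
  have h1 : 0 < 1 / α := by positivity
  have h2 : 0 < 1 / T := by positivity
  rcases le_total 0 x with h | h
  · rw [abs_of_nonneg h]
    have : x * Real.exp (s * x) ≤ x * Real.exp (T * x) := by gcongr
    linarith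
  · rw [abs_of_nonpos h]
    have h3 := neg_mul_exp_le (x := x) hT
    have h4 := neg_mul_exp_le (x := x) hα
    have h5 : Real.exp (s * x) ≤ Real.exp (α * x) := by
      rw [Real.exp_le_exp]; nlinarith
    have : -x * Real.exp (s * x) ≤ -x * Real.exp (α * x) :=
      mul_le_mul_of_nonneg_left h5 (by linarith)
    linarith

theorem abs_weightedExpSum_le {α s T : ℝ} (hα : 0 < α) (hs : α ≤ s) (hsT : s ≤ T)
    (z : Offspring) :
    |weightedExpSum s z| ≤ weightedExpSum T z + expSum 0 z * (1 / α + 1 / T) := by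
  rw [weightedExpSum, weightedExpSum, expSum, Finset.sum_mul, ← Finset.sum_add_distrib]
  refine (Finset.abs_sum_le_sum_abs _ _).trans (Finset.sum_le_sum fun k _ => ?_)
  rw [abs_mul, Real.abs_exp, zero_mul, Real.exp_zero, one_mul]
  exact abs_mul_exp_le hα hs hsT

variable {ρ : Measure Offspring} {T : ℝ}

theorem LaplaceFinite.of_le (h0 : LaplaceFinite ρ 0) (hT : LaplaceFinite ρ T) {s : ℝ}
    (hs : 0 ≤ s) (hsT : s ≤ T) : LaplaceFinite ρ s := by
  refine Integrable.mono' (h0.add hT) (measurable_expSum s).aestronglyMeasurable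
    (.of_forall fun z => ?_)
  rw [Real.norm_of_nonneg (expSum_nonneg s z)]
  exact expSum_le_add hs hsT z

theorem integrable_weightedExpSum_of_le (h0 : LaplaceFinite ρ 0)
    (hT : Integrable (weightedExpSum T) ρ) {s : ℝ} (hs : 0 < s) (hsT : s ≤ T) :
    Integrable (weightedExpSum s) ρ :=
  Integrable.mono' (hT.add (h0.mul_const (1 / s + 1 / T)))
    (measurable_weightedExpSum s).aestronglyMeasurable
    (.of_forall fun z => abs_weightedExpSum_le hs le_rfl hsT z)

/-- `m(t) = 𝔼[∑_{k < N} e^{t ξ_k}]`, so that `ν = log m`. -/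
noncomputable def laplace (ρ : Measure Offspring) (t : ℝ) : ℝ := ∫ z, expSum t z ∂ρ

/-- `m'(t) = 𝔼[∑_{k < N} ξ_k e^{t ξ_k}]`. -/
noncomputable def laplaceDeriv (ρ : Measure Offspring) (t : ℝ) : ℝ :=
  ∫ z, weightedExpSum t z ∂ρ

theorem continuousOn_laplace (h0 : LaplaceFinite ρ 0) (hT : LaplaceFinite ρ T) :
    ContinuousOn (laplace ρ) (Set.Icc 0 T) := by
  refine continuousOn_of_dominated (bound := fun z => expSum 0 z + expSum T z)
    (fun s _ => (measurable_expSum s).aestronglyMeasurable) (fun s hs => .of_forall fun z => ?_)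
    (h0.add hT) (.of_forall fun z => ?_)
  · rw [Real.norm_of_nonneg (expSum_nonneg s z)]
    exact expSum_le_add hs.1 hs.2 z
  · unfold expSum; fun_prop

theorem continuousOn_laplaceDeriv (h0 : LaplaceFinite ρ 0)
    (hT : Integrable (weightedExpSum T) ρ) {α : ℝ} (hα : 0 < α) :
    ContinuousOn (laplaceDeriv ρ) (Set.Icc α T) := by
  refine continuousOn_of_dominated
    (bound := fun z => weightedExpSum T z + expSum 0 z * (1 / α + 1 / T))
    (fun s _ => (measurable_weightedExpSum s).aestronglyMeasurable)
    (fun s hs => .of_forall fun z => ?_)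
    (hT.add (h0.mul_const _)) (.of_forall fun z => ?_)
  · exact abs_weightedExpSum_le hα hs.1 hs.2 z
  · unfold weightedExpSum; fun_prop

theorem hasDerivAt_laplace (h0 : LaplaceFinite ρ 0) (hT : LaplaceFinite ρ T)
    (hT' : Integrable (weightedExpSum T) ρ) {t : ℝ} (ht : 0 < t) (htT : t < T) :
    HasDerivAt (laplace ρ) (laplaceDeriv ρ t) t := by
  refine (hasDerivAt_integral_of_dominated_loc_of_deriv_le (F := fun s z => expSum s z)
    (F' := fun s z => weightedExpSum s z)
    (bound := fun z => weightedExpSum T z + expSum 0 z * (1 / (t / 2) + 1 / T))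
    (s := Set.Ioo (t / 2) T) (Ioo_mem_nhds (by linarith) htT)
    (.of_forall fun s => (measurable_expSum s).aestronglyMeasurable)
    (h0.of_le hT ht.le htT.le) (measurable_weightedExpSum t).aestronglyMeasurable
    (.of_forall fun z s hs => ?_) (hT'.add (h0.mul_const _)) (.of_forall fun z s _ => ?_)).2
  · exact abs_weightedExpSum_le (by linarith) hs.1.le hs.2.le z
  · unfold expSum weightedExpSum
    refine HasDerivAt.fun_sum fun k _ => ?_
    have := ((hasDerivAt_id s).mul_const (z.2 k)).exp
    simpa [mul_comm] using this

theorem laplace_pos [IsProbabilityMeasure ρ] (hsurv : ρ {z | z.1 = 0} = 0) {t : ℝ}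
    (ht : LaplaceFinite ρ t) : 0 < laplace ρ t := by
  rw [laplace, integral_pos_iff_support_of_nonneg (expSum_nonneg t) ht]
  have : {z : Offspring | z.1 = 0}ᶜ ⊆ Function.support (expSum t) := by
    intro z hz
    refine (Finset.sum_pos (fun k _ => Real.exp_pos _) ?_).ne'
    simpa using hz
  refine lt_of_lt_of_le ?_ (measure_mono this)
  have h : ∀ᵐ z ∂ρ, z ∈ {z : Offspring | z.1 = 0}ᶜ := by
    rw [ae_iff]; simpa using hsurv
  rw [(prob_compl_eq_one_iff₀ (NullMeasurableSet.of_null hsurv)).2 hsurv]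
  exact one_pos

/-- `m(t) (ν(t) - t ν'(t))`. Where `ν` and `ν'` are finite, its zeros are the critical
parameters, and its sign is that of the growth rate `ν(t) - t ν'(t)` of the number of particles
travelling at speed `ν'(t)`. -/
noncomputable def growthRate (ρ : Measure Offspring) (t : ℝ) : ℝ :=
  laplace ρ t * Real.log (laplace ρ t) - t * laplaceDeriv ρ t

theorem mem_criticalSet_iff [IsProbabilityMeasure ρ] (hsurv : ρ {z | z.1 = 0} = 0) {t : ℝ}
    (ht : 0 < t) (h1 : LaplaceFinite ρ t) (h2 : Integrable (weightedExpSum t) ρ) :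
    t ∈ criticalSet ρ ↔ growthRate ρ t = 0 := by
  have hm := laplace_pos hsurv h1
  have : nu ρ t = Real.log (laplace ρ t) := rfl
  have h3 : nuPrime ρ t = laplaceDeriv ρ t / laplace ρ t := by
    rw [nuPrime, this, Real.exp_neg, Real.exp_log hm, laplaceDeriv]; field_simp
  simp only [criticalSet, Set.mem_ofPred_eq, ht, h1, h2, true_and, this, h3]
  rw [growthRate, sub_eq_zero]
  constructor
  · intro h; rw [h]; field_simp
  · intro h; field_simp; linarith

end

/-! ### The critical parameter -/

section

variable {ρ : Measure Offspring} {θ₀ : ℝ}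

theorem ae_one_le_offspring (hsurv : ρ {z | z.1 = 0} = 0) : ∀ᵐ z ∂ρ, 1 ≤ z.1 := by
  rw [ae_iff]
  convert hsurv using 3
  simp

theorem continuousOn_growthRate [IsProbabilityMeasure ρ] (hsurv : ρ {z | z.1 = 0} = 0)
    (h0 : LaplaceFinite ρ 0) {T : ℝ}
    (hT : LaplaceFinite ρ T) (hT' : Integrable (weightedExpSum T) ρ) {α : ℝ} (hα : 0 < α) :
    ContinuousOn (growthRate ρ) (Set.Icc α T) := by
  have h := (continuousOn_laplace h0 hT).mono (Set.Icc_subset_Icc_left hα.le)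
  refine (h.mul (h.log fun s hs => ?_)).sub
    (continuousOn_id.mul (continuousOn_laplaceDeriv h0 hT' hα))
  exact (laplace_pos hsurv (h0.of_le hT (hα.le.trans hs.1) hs.2)).ne'

theorem le_of_mem_criticalSet (hθ₀ : criticalParam ρ = (θ₀ : EReal)) {t : ℝ}
    (ht : t ∈ criticalSet ρ) : θ₀ ≤ t := by
  have : criticalParam ρ ≤ (t : EReal) := sInf_le ⟨t, ht, rfl⟩
  rw [hθ₀] at this
  exact_mod_cast this

/-- The infimum defining the critical parameter is attained. -/
theorem criticalParam_mem_criticalSet [IsProbabilityMeasure ρ] (hsurv : ρ {z | z.1 = 0} = 0)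
    (h0 : LaplaceFinite ρ 0)
    (hθ₀ : criticalParam ρ = (θ₀ : EReal)) (hθ₀_pos : 0 < θ₀) : θ₀ ∈ criticalSet ρ := by
  have hex : ∀ x, θ₀ < x → ∃ t ∈ criticalSet ρ, t < x := by
    intro x hx
    have h : sInf ((fun t : ℝ => (t : EReal)) '' criticalSet ρ) < (x : EReal) := by
      rw [criticalParam] at hθ₀
      rw [hθ₀]; exact_mod_cast hx
    obtain ⟨_, ⟨t, ht, rfl⟩, htx⟩ := sInf_lt_iff.1 h
    exact ⟨t, ht, EReal.coe_lt_coe_iff.1 htx⟩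
  obtain ⟨T, hT, -⟩ := hex (θ₀ + 1) (by linarith)
  have hTle := le_of_mem_criticalSet hθ₀ hT
  rw [mem_criticalSet_iff hsurv hθ₀_pos (h0.of_le hT.2.1 hθ₀_pos.le hTle)
    (integrable_weightedExpSum_of_le h0 hT.2.2.1 hθ₀_pos hTle)]
  have hcont := continuousOn_growthRate hsurv h0 hT.2.1 hT.2.2.1 hθ₀_pos
  have hclosed : IsClosed (Set.Icc θ₀ T ∩ growthRate ρ ⁻¹' {0}) :=
    hcont.preimage_isClosed_of_isClosed isClosed_Icc isClosed_singleton
  have hmem : θ₀ ∈ closure (Set.Icc θ₀ T ∩ growthRate ρ ⁻¹' {0}) := by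
    rw [Metric.mem_closure_iff]
    intro ε hε
    obtain ⟨t, ht, hlt⟩ := hex (θ₀ + ε) (by linarith)
    have hle := le_of_mem_criticalSet hθ₀ ht
    have hz : ∀ s ∈ criticalSet ρ, growthRate ρ s = 0 := fun s hs =>
      (mem_criticalSet_iff hsurv hs.1 hs.2.1 hs.2.2.1).1 hs
    by_cases htT : t ≤ T
    · refine ⟨t, ⟨⟨hle, htT⟩, hz t ht⟩, ?_⟩
      rw [dist_comm, Real.dist_eq, abs_of_nonneg (by linarith)]; linarith
    · refine ⟨T, ⟨⟨hTle, le_rfl⟩, hz T hT⟩, ?_⟩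
      rw [dist_comm, Real.dist_eq, abs_of_nonneg (by linarith)]; linarith
  exact (hclosed.closure_eq ▸ hmem).2

/-- If every particle had exactly one child, a critical parameter would be an equality case of
Jensen's inequality; the displacement would then be constant, every `t > 0` would be critical and
the critical parameter would be `0`. -/
theorem not_ae_eq_one [IsProbabilityMeasure ρ] (hsurv : ρ {z | z.1 = 0} = 0)
    (h0 : LaplaceFinite ρ 0)
    (hθ₀ : criticalParam ρ = (θ₀ : EReal)) (hθ₀_pos : 0 < θ₀) : ¬ ∀ᵐ z ∂ρ, z.1 = 1 := by
  intro h1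
  have hmem := criticalParam_mem_criticalSet hsurv h0 hθ₀ hθ₀_pos
  have hzero := (mem_criticalSet_iff hsurv hmem.1 hmem.2.1 hmem.2.2.1).1 hmem
  set m := laplace ρ θ₀ with hm
  have hmpos : 0 < m := laplace_pos hsurv hmem.2.1
  -- With `w = e^{θ₀ ξ} / m`, this is `m (w log w - w + 1) ≥ 0`, whose integral vanishes.
  set F : Offspring → ℝ := fun z =>
    θ₀ * weightedExpSum θ₀ z - (Real.log m + 1) * expSum θ₀ z + m with hF
  have hi1 : Integrable (fun z => θ₀ * weightedExpSum θ₀ z) ρ := hmem.2.2.1.const_mul _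
  have hi2 : Integrable (fun z => (Real.log m + 1) * expSum θ₀ z) ρ :=
    Integrable.const_mul hmem.2.1 _
  have hFi : Integrable F ρ := (hi1.sub hi2).add (integrable_const _)
  have hF0 : ∫ z, F z ∂ρ = 0 := by
    have h2 := integral_add (hi1.sub hi2) (integrable_const (μ := ρ) m)
    rw [integral_sub' hi1 hi2, integral_const_mul, integral_const_mul] at h2
    refine h2.trans ?_
    change θ₀ * laplaceDeriv ρ θ₀ - (Real.log m + 1) * m + _ = 0
    simp only [integral_const, probReal_univ, smul_eq_mul, one_mul]
    rw [growthRate, ← hm] at hzero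
    linarith
  have hform : ∀ᵐ z ∂ρ, F z = Real.exp (θ₀ * z.2 0) * (θ₀ * z.2 0 - Real.log m)
      - Real.exp (θ₀ * z.2 0) + m := by
    filter_upwards [h1] with z hz
    simp only [hF, weightedExpSum, expSum, hz, Finset.sum_range_one]; ring
  have hkey : ∀ u : ℝ, u ≠ 0 → 0 < Real.exp u * u - Real.exp u + 1 := by
    intro u hu
    have h2 := Real.add_one_lt_exp (neg_ne_zero.2 hu)
    have h3 : Real.exp (-u) * Real.exp u = 1 := by rw [← Real.exp_add]; simp
    nlinarith [Real.exp_pos u]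
  have hpos : ∀ x : ℝ, Real.exp x * (x - Real.log m) - Real.exp x + m =
      m * (Real.exp (x - Real.log m) * (x - Real.log m) - Real.exp (x - Real.log m) + 1) := by
    intro x
    rw [Real.exp_sub, Real.exp_log hmpos]; field_simp
  have hFnn : 0 ≤ᵐ[ρ] F := by
    filter_upwards [hform] with z hz
    rw [hz, hpos]
    refine mul_nonneg hmpos.le ?_
    by_cases hu : θ₀ * z.2 0 - Real.log m = 0
    · rw [hu]; simp
    · exact (hkey _ hu).le
  have hae := (integral_eq_zero_iff_of_nonneg_ae hFnn hFi).1 hF0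
  set c := Real.log m / θ₀ with hc
  have hconst : ∀ᵐ z ∂ρ, z.2 0 = c := by
    filter_upwards [hform, hae] with z hz hz0
    by_contra hne
    have hu : θ₀ * z.2 0 - Real.log m ≠ 0 := by
      intro h; apply hne; rw [hc]; field_simp; linarith
    have := mul_pos hmpos (hkey _ hu)
    rw [← hpos, ← hz, hz0] at this
    simp at this
  have hval : ∀ f : ℝ → ℝ,
      (fun z : Offspring => ∑ k ∈ Finset.range z.1, f (z.2 k)) =ᵐ[ρ] fun _ => f c := by
    intro f
    filter_upwards [h1, hconst] with z hz hzc
    simp [hz, hzc]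
  have hs : 0 < θ₀ / 2 := by linarith
  have he := hval (fun x => Real.exp (θ₀ / 2 * x))
  have hw := hval (fun x => x * Real.exp (θ₀ / 2 * x))
  have hcrit : θ₀ / 2 ∈ criticalSet ρ := by
    rw [mem_criticalSet_iff hsurv hs ((integrable_const _).congr he.symm)
      ((integrable_const _).congr hw.symm)]
    have e1 : laplace ρ (θ₀ / 2) = Real.exp (θ₀ / 2 * c) := by
      rw [laplace]; exact (integral_congr_ae he).trans (by simp)
    have e2 : laplaceDeriv ρ (θ₀ / 2) = c * Real.exp (θ₀ / 2 * c) := by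
      rw [laplaceDeriv]; exact (integral_congr_ae hw).trans (by simp)
    rw [growthRate, e1, e2, Real.log_exp]; ring
  have := le_of_mem_criticalSet hθ₀ hcrit
  linarith

theorem one_lt_laplace_zero [IsProbabilityMeasure ρ] (hsurv : ρ {z | z.1 = 0} = 0)
    (h0 : LaplaceFinite ρ 0)
    (h1 : ¬ ∀ᵐ z ∂ρ, z.1 = 1) : 1 < laplace ρ 0 := by
  have hone := ae_one_le_offspring hsurv
  have hnn : 0 ≤ᵐ[ρ] fun z => expSum 0 z - 1 := by
    filter_upwards [hone] with z hz
    rw [expSum_zero]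
    have : (1 : ℝ) ≤ z.1 := by exact_mod_cast hz
    simpa using this
  have hi : Integrable (fun z => expSum 0 z - 1) ρ := Integrable.sub h0 (integrable_const _)
  have hint : ∫ z, (expSum 0 z - 1) ∂ρ = laplace ρ 0 - 1 := by
    rw [integral_sub h0 (integrable_const _), laplace]; simp
  have hge : 0 ≤ laplace ρ 0 - 1 := hint ▸ integral_nonneg_of_ae hnn
  refine lt_of_le_of_ne (by linarith) fun heq => h1 ?_
  have := (integral_eq_zero_iff_of_nonneg_ae hnn hi).1 (by rw [hint, ← heq]; simp)
  filter_upwards [this] with z hz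
  rw [expSum_zero] at hz
  have hz' : (z.1 : ℝ) = 1 := by simp only [Pi.zero_apply] at hz; linarith
  exact_mod_cast hz'

/-- `t m'(t) → 0` as `t ↓ 0`, which needs no integrability of `∑_{k < N} ξ_k`. -/
theorem tendsto_mul_laplaceDeriv_zero (h0 : LaplaceFinite ρ 0) {T : ℝ} (hTpos : 0 < T)
    (hT : LaplaceFinite ρ T) :
    Tendsto (fun t => t * laplaceDeriv ρ t) (𝓝[>] 0) (𝓝 0) := by
  have hlim : Tendsto (fun t => ∫ z, t * weightedExpSum t z ∂ρ) (𝓝[>] 0)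
      (𝓝 (∫ _, (0 : ℝ) ∂ρ)) := by
    refine tendsto_integral_filter_of_dominated_convergence
      (fun z => expSum 0 z + expSum T z)
      (.of_forall fun t => ((measurable_weightedExpSum t).const_mul t).aestronglyMeasurable)
      ?_ (h0.add hT) (.of_forall fun z => ?_)
    · have hmem : Set.Ioo (0 : ℝ) (T / 2) ∈ 𝓝[>] (0 : ℝ) := Ioo_mem_nhdsGT (by linarith)
      filter_upwards [hmem] with t ht
      refine .of_forall fun z => ?_
      rw [weightedExpSum, expSum, expSum, ← Finset.sum_add_distrib, Finset.mul_sum]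
      refine (norm_sum_le _ _).trans (Finset.sum_le_sum fun k _ => ?_)
      set x := z.2 k
      rw [norm_mul, norm_mul, Real.norm_of_nonneg ht.1.le, Real.norm_eq_abs,
        Real.norm_of_nonneg (Real.exp_pos _).le, zero_mul, Real.exp_zero]
      rcases le_total 0 x with h | h
      · rw [abs_of_nonneg h]
        have h2 : t * x ≤ Real.exp (t * x) := by linarith [Real.add_one_le_exp (t * x)]
        have h3 : Real.exp (t * x) * Real.exp (t * x) ≤ Real.exp (T * x) := by
          rw [← Real.exp_add, Real.exp_le_exp]; nlinarith [ht.2]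
        nlinarith [Real.exp_pos (t * x)]
      · rw [abs_of_nonpos h]
        have h2 := neg_mul_exp_le (x := x) ht.1
        have h3 := Real.exp_pos (T * x)
        rw [le_div_iff₀ ht.1] at h2
        linarith
    · have : Tendsto (fun t => t * weightedExpSum t z) (𝓝 0) (𝓝 (0 * weightedExpSum 0 z)) := by
        apply Continuous.tendsto'
        · unfold weightedExpSum; fun_prop
        · rfl
      rw [zero_mul] at this
      exact this.mono_left nhdsWithin_le_nhds
  simpa [integral_const_mul, laplaceDeriv] using hlim

/-- Below the critical parameter, `ν(t) > t ν'(t)`. -/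
theorem growthRate_pos [IsProbabilityMeasure ρ] (hsurv : ρ {z | z.1 = 0} = 0)
    (h0 : LaplaceFinite ρ 0)
    (hθ₀ : criticalParam ρ = (θ₀ : EReal)) (hθ₀_pos : 0 < θ₀) {t : ℝ} (ht : 0 < t)
    (htθ : t < θ₀) : 0 < growthRate ρ t := by
  have hmem := criticalParam_mem_criticalSet hsurv h0 hθ₀ hθ₀_pos
  have hm0 := one_lt_laplace_zero hsurv h0 (not_ae_eq_one hsurv h0 hθ₀ hθ₀_pos)
  have hlim : Tendsto (growthRate ρ) (𝓝[>] 0)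
      (𝓝 (laplace ρ 0 * Real.log (laplace ρ 0) - 0)) := by
    have hc : Tendsto (laplace ρ) (𝓝[>] 0) (𝓝 (laplace ρ 0)) := by
      have := (continuousOn_laplace h0 hmem.2.1) 0 ⟨le_rfl, hθ₀_pos.le⟩
      refine this.tendsto.mono_left (nhdsWithin_le_iff.2 ?_)
      exact mem_of_superset (Ioo_mem_nhdsGT hθ₀_pos) Set.Ioo_subset_Icc_self
    exact (hc.mul (hc.log (by linarith))).sub
      (tendsto_mul_laplaceDeriv_zero h0 hθ₀_pos hmem.2.1)
  have hpos : 0 < laplace ρ 0 * Real.log (laplace ρ 0) - 0 := by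
    rw [sub_zero]; exact mul_pos (by linarith) (Real.log_pos hm0)
  obtain ⟨s, hs1, hs2⟩ := ((hlim.eventually (lt_mem_nhds hpos)).and
    (Ioo_mem_nhdsGT ht)).exists
  by_contra hneg
  rw [not_lt] at hneg
  have hcont := (continuousOn_growthRate hsurv h0 hmem.2.1 hmem.2.2.1 hs2.1).mono
    (Set.Icc_subset_Icc_right htθ.le)
  obtain ⟨u, hu, hu0⟩ := intermediate_value_Icc' hs2.2.le hcont ⟨hneg, hs1.le⟩
  have hu_pos : 0 < u := hs2.1.trans_le hu.1
  have hu_le : u ≤ θ₀ := hu.2.trans htθ.le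
  have := le_of_mem_criticalSet hθ₀ ((mem_criticalSet_iff hsurv hu_pos
    (h0.of_le hmem.2.1 hu_pos.le hu_le)
    (integrable_weightedExpSum_of_le h0 hmem.2.2.1 hu_pos hu_le)).2 hu0)
  linarith [hu.2]

end

/-! ### The branching operator -/

section

/-- The branching operator `T f (y) = 𝔼[∏_{k < N} f(y - ξ_k)]`. If `f` is the distribution
function of the rightmost position in one generation, `T f` is that of the next generation. -/
noncomputable def branch (ρ : Measure Offspring) (f : ℝ → ℝ) (y : ℝ) : ℝ :=
  ∫ z, ∏ k ∈ Finset.range z.1, f (y - z.2 k) ∂ρ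

/-- The linearisation `L f (y) = 𝔼[∑_{k < N} f(y - ξ_k)]` of the branching operator at the
constant function `1`. -/
noncomputable def branchSum (ρ : Measure Offspring) (f : ℝ → ℝ) (y : ℝ) : ℝ :=
  ∫ z, ∑ k ∈ Finset.range z.1, f (y - z.2 k) ∂ρ

/-- Non-decreasing functions with values in `[0, 1]`: the shape of `x ↦ P(R < x)`. -/
structure IsSubCDF (f : ℝ → ℝ) : Prop where
  mono : Monotone f
  nonneg : ∀ x, 0 ≤ f x
  le_one : ∀ x, f x ≤ 1

section Elementary

variable {c b : ℕ → ℝ}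

theorem one_sub_prod_range_le (h0 : ∀ k, 0 ≤ c k) (h1 : ∀ k, c k ≤ 1) (n : ℕ) :
    1 - ∏ k ∈ Finset.range n, c k ≤ ∑ k ∈ Finset.range n, (1 - c k) := by
  induction n with
  | zero => simp
  | succ n ih =>
    rw [Finset.prod_range_succ, Finset.sum_range_succ]
    have hP : ∏ k ∈ Finset.range n, c k ≤ 1 := Finset.prod_le_one (fun k _ => h0 k) fun k _ => h1 k
    nlinarith [h1 n]

/-- A union bound, keeping the product of the constant parts. -/
theorem prod_range_le_pow_add_sum {a : ℝ} (ha0 : 0 ≤ a) (ha1 : a ≤ 1) (h0 : ∀ k, 0 ≤ c k)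
    (h1 : ∀ k, c k ≤ 1) (hb : ∀ k, 0 ≤ b k) (hc : ∀ k, c k ≤ a + b k) (n : ℕ) :
    ∏ k ∈ Finset.range n, c k ≤ a ^ n + ∑ k ∈ Finset.range n, b k := by
  induction n with
  | zero => simp
  | succ n ih =>
    rw [Finset.prod_range_succ, Finset.sum_range_succ, pow_succ]
    set p := ∏ k ∈ Finset.range n, c k
    have hp1 : p ≤ 1 := Finset.prod_le_one (fun k _ => h0 k) fun k _ => h1 k
    have hp0 : 0 ≤ p := Finset.prod_nonneg fun k _ => h0 k
    have hS : 0 ≤ ∑ k ∈ Finset.range n, b k := Finset.sum_nonneg fun k _ => hb k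
    calc p * c n ≤ p * (a + b n) := mul_le_mul_of_nonneg_left (hc n) hp0
      _ ≤ p * a + b n := by nlinarith [hb n]
      _ ≤ (a ^ n + ∑ k ∈ Finset.range n, b k) * a + b n := by gcongr
      _ ≤ a ^ n * a + (∑ k ∈ Finset.range n, b k + b n) := by nlinarith

theorem tendsto_one_sub_prod_div {l : Filter ℝ} (hl : l ≤ 𝓝 0) {c : ℝ → ℕ → ℝ} {A : ℕ → ℝ}
    (hA : ∀ k, Tendsto (fun γ => (1 - c γ k) / γ) l (𝓝 (A k)))
    (hne : ∀ᶠ γ in l, γ ≠ 0) (n : ℕ) :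
    Tendsto (fun γ => (1 - ∏ k ∈ Finset.range n, c γ k) / γ) l
      (𝓝 (∑ k ∈ Finset.range n, A k)) := by
  induction n with
  | zero => simpa using tendsto_const_nhds
  | succ n ih =>
    have hP : Tendsto (fun γ => ∏ k ∈ Finset.range n, c γ k) l (𝓝 1) := by
      have h : Tendsto (fun γ : ℝ => 1 - γ * ((1 - ∏ k ∈ Finset.range n, c γ k) / γ)) l
          (𝓝 (1 - 0 * ∑ k ∈ Finset.range n, A k)) :=
        tendsto_const_nhds.sub ((tendsto_id'.2 hl).mul ih)
      rw [zero_mul, sub_zero] at h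
      refine h.congr' ?_
      filter_upwards [hne] with γ hγ
      field_simp; ring
    have := ih.add (hP.mul (hA n))
    rw [one_mul, ← Finset.sum_range_succ] at this
    refine this.congr fun γ => ?_
    rw [Finset.prod_range_succ]; ring

end Elementary

variable {ρ : Measure Offspring} {f g : ℝ → ℝ}

theorem expSum_shift (t y : ℝ) (z : Offspring) :
    ∑ k ∈ Finset.range z.1, Real.exp (-t * (y - z.2 k)) = Real.exp (-t * y) * expSum t z := by
  rw [expSum, Finset.mul_sum]
  refine Finset.sum_congr rfl fun k _ => ?_
  rw [← Real.exp_add]; ring_nf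

theorem IsSubCDF.measurable_prod (hf : IsSubCDF f) (y : ℝ) :
    Measurable fun z : Offspring => ∏ k ∈ Finset.range z.1, f (y - z.2 k) :=
  measurable_prod_range_offspring (f := fun x => f (y - x))
    (hf.mono.measurable.comp (measurable_const.sub measurable_id))

theorem IsSubCDF.prod_nonneg (hf : IsSubCDF f) (y : ℝ) (z : Offspring) :
    0 ≤ ∏ k ∈ Finset.range z.1, f (y - z.2 k) := Finset.prod_nonneg fun _ _ => hf.nonneg _

theorem IsSubCDF.prod_le_one (hf : IsSubCDF f) (y : ℝ) (z : Offspring) :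
    ∏ k ∈ Finset.range z.1, f (y - z.2 k) ≤ 1 :=
  Finset.prod_le_one (fun _ _ => hf.nonneg _) fun _ _ => hf.le_one _

variable [IsProbabilityMeasure ρ]

theorem IsSubCDF.integrable_prod (hf : IsSubCDF f) (y : ℝ) :
    Integrable (fun z : Offspring => ∏ k ∈ Finset.range z.1, f (y - z.2 k)) ρ :=
  Integrable.of_bound (hf.measurable_prod y).aestronglyMeasurable 1 (.of_forall fun z => by
    rw [Real.norm_of_nonneg (hf.prod_nonneg y z)]; exact hf.prod_le_one y z)

theorem IsSubCDF.branch_le_branch (hf : IsSubCDF f) (hg : IsSubCDF g) {x y : ℝ}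
    (h : ∀ s, f (x - s) ≤ g (y - s)) : branch ρ f x ≤ branch ρ g y :=
  integral_mono (hf.integrable_prod x) (hg.integrable_prod y) fun _ =>
    Finset.prod_le_prod (fun _ _ => hf.nonneg _) fun _ _ => h _

theorem IsSubCDF.branch (hf : IsSubCDF f) : IsSubCDF (branch ρ f) where
  mono _ _ h := hf.branch_le_branch hf fun _ => hf.mono (by linarith)
  nonneg y := integral_nonneg (hf.prod_nonneg y)
  le_one y := by
    have := integral_mono (hf.integrable_prod y) (integrable_const (μ := ρ) (1 : ℝ))
      (hf.prod_le_one y)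
    simpa [PerturbedBRW.branch] using this

theorem IsSubCDF.iterate_branch (hf : IsSubCDF f) (n : ℕ) :
    IsSubCDF ((PerturbedBRW.branch ρ)^[n] f) := by
  induction n with
  | zero => exact hf
  | succ n ih => rw [Function.iterate_succ_apply']; exact ih.branch

theorem IsSubCDF.iterate_branch_le (hf : IsSubCDF f) (hg : IsSubCDF g) {c : ℝ}
    (h : ∀ y, f y ≤ g (y - c)) (n : ℕ) (y : ℝ) :
    (PerturbedBRW.branch ρ)^[n] f y ≤ (PerturbedBRW.branch ρ)^[n] g (y - c) := by
  induction n generalizing y with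
  | zero => exact h y
  | succ n ih =>
    rw [Function.iterate_succ_apply', Function.iterate_succ_apply']
    refine (hf.iterate_branch n).branch_le_branch (hg.iterate_branch n) fun s => ?_
    rw [sub_right_comm]; exact ih _

/-- First-moment bound for the tails of the iterates of the branching operator. -/
theorem IsSubCDF.one_sub_iterate_branch_le (hf : IsSubCDF f) {t C : ℝ}
    (ht : LaplaceFinite ρ t) (h : ∀ y, 1 - f y ≤ C * Real.exp (-t * y)) (n : ℕ) (y : ℝ) :
    1 - (PerturbedBRW.branch ρ)^[n] f y ≤ C * laplace ρ t ^ n * Real.exp (-t * y) := by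
  induction n generalizing y with
  | zero => simpa using h y
  | succ n ih =>
    rw [Function.iterate_succ_apply']
    have hn := hf.iterate_branch (ρ := ρ) n
    set F := (PerturbedBRW.branch ρ)^[n] f
    have h1 : 1 - PerturbedBRW.branch ρ F y =
        ∫ z, (1 - ∏ k ∈ Finset.range z.1, F (y - z.2 k)) ∂ρ := by
      rw [integral_sub (integrable_const _) (hn.integrable_prod y)]
      simp [PerturbedBRW.branch]
    have h2 : C * laplace ρ t ^ (n + 1) * Real.exp (-t * y) =
        ∫ z, C * laplace ρ t ^ n * (Real.exp (-t * y) * expSum t z) ∂ρ := by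
      rw [integral_const_mul, integral_const_mul, ← laplace]; ring
    rw [h1, h2]
    refine integral_mono ((integrable_const _).sub (hn.integrable_prod y))
      ((ht.const_mul _).const_mul _) fun z => ?_
    refine (one_sub_prod_range_le (fun _ => hn.nonneg _) (fun _ => hn.le_one _) _).trans ?_
    rw [← expSum_shift, Finset.mul_sum]
    exact Finset.sum_le_sum fun k _ => ih _

end

/-! ### Expected number of particles beyond a level -/

section

variable {ρ : Measure Offspring}

/-- The expected number of particles of generation `n` whose position is at least `y`. -/
noncomputable def expectedCount (ρ : Measure Offspring) (n : ℕ) : ℝ → ℝ :=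
  (branchSum ρ)^[n] (Set.indicator (Set.Iic 0) 1)

theorem expectedCount_succ (n : ℕ) (y : ℝ) :
    expectedCount ρ (n + 1) y =
      ∫ z, ∑ k ∈ Finset.range z.1, expectedCount ρ n (y - z.2 k) ∂ρ := by
  rw [expectedCount, Function.iterate_succ_apply']; rfl

variable [IsProbabilityMeasure ρ]

/-- The function that is `1 - γ` up to `0` and `1` beyond. -/
noncomputable def stepFun (γ : ℝ) (y : ℝ) : ℝ := if y ≤ 0 then 1 - γ else 1

theorem isSubCDF_stepFun {γ : ℝ} (h0 : 0 ≤ γ) (h1 : γ ≤ 1) : IsSubCDF (stepFun γ) where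
  mono x y hxy := by
    unfold stepFun; split_ifs <;> linarith
  nonneg x := by unfold stepFun; split_ifs <;> linarith
  le_one x := by unfold stepFun; split_ifs <;> linarith

/-- The expected number of particles beyond a level is the derivative, at `γ = 0`, of the
probability that one of these particles is selected when each is with probability `γ`. -/
theorem tendsto_one_sub_iterate_branch_stepFun (h0 : LaplaceFinite ρ 0) (n : ℕ) (y : ℝ) :
    Tendsto (fun γ => (1 - (branch ρ)^[n] (stepFun γ) y) / γ) (𝓝[>] 0)
      (𝓝 (expectedCount ρ n y)) := by
  have hγ : ∀ᶠ γ : ℝ in 𝓝[>] 0, γ ∈ Set.Ioo (0 : ℝ) 1 := Ioo_mem_nhdsGT one_pos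
  induction n generalizing y with
  | zero =>
    refine tendsto_const_nhds.congr' ?_
    filter_upwards [hγ] with γ h
    have := h.1.ne'
    simp only [expectedCount, Function.iterate_zero, id, stepFun, Set.indicator, Set.mem_Iic,
      Pi.one_apply]
    split_ifs <;> simp [this]
  | succ n ih =>
    rw [expectedCount_succ]
    have hform : ∀ᶠ γ : ℝ in 𝓝[>] 0,
        ∫ z, (1 - ∏ k ∈ Finset.range z.1, (branch ρ)^[n] (stepFun γ) (y - z.2 k)) / γ ∂ρ =
          (1 - (branch ρ)^[n + 1] (stepFun γ) y) / γ := by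
      filter_upwards [hγ] with γ h
      have hn := (isSubCDF_stepFun h.1.le h.2.le).iterate_branch (ρ := ρ) n
      rw [integral_div, integral_sub (integrable_const _) (hn.integrable_prod y),
        Function.iterate_succ_apply']
      simp [branch]
    refine Tendsto.congr' hform ?_
    refine tendsto_integral_filter_of_dominated_convergence
      (fun z => laplace ρ 0 ^ n * expSum 0 z) ?_ ?_ (h0.const_mul _) (.of_forall fun z => ?_)
    · filter_upwards [hγ] with γ h
      have hn := (isSubCDF_stepFun h.1.le h.2.le).iterate_branch (ρ := ρ) n
      exact ((measurable_const.sub (hn.measurable_prod y)).div_const γ).aestronglyMeasurable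
    · filter_upwards [hγ] with γ h
      refine .of_forall fun z => ?_
      have hs := isSubCDF_stepFun h.1.le h.2.le
      have hn := hs.iterate_branch (ρ := ρ) n
      have hle := hs.one_sub_iterate_branch_le h0 (C := γ) (fun x => by
        unfold stepFun; split_ifs <;> simp [h.1.le]) n
      rw [Real.norm_of_nonneg (div_nonneg (sub_nonneg.2 (hn.prod_le_one y z)) h.1.le),
        div_le_iff₀ h.1]
      refine (one_sub_prod_range_le (fun _ => hn.nonneg _) (fun _ => hn.le_one _) _).trans ?_
      refine (Finset.sum_le_sum fun k _ => hle _).trans (le_of_eq ?_)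
      simp [expSum_zero]; ring
    · exact tendsto_one_sub_prod_div nhdsWithin_le_nhds (fun k => ih _)
        (hγ.mono fun γ h => h.1.ne') _

end

section

variable {ρ : Measure Offspring} [IsProbabilityMeasure ρ] {f : ℝ → ℝ}

theorem antitone_expectedCount (h0 : LaplaceFinite ρ 0) (n : ℕ) :
    Antitone (expectedCount ρ n) := by
  intro x y hxy
  refine le_of_tendsto_of_tendsto (tendsto_one_sub_iterate_branch_stepFun h0 n y)
    (tendsto_one_sub_iterate_branch_stepFun h0 n x) ?_
  filter_upwards [Ioo_mem_nhdsGT one_pos] with γ h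
  have := ((isSubCDF_stepFun h.1.le h.2.le).iterate_branch (ρ := ρ) n).mono hxy
  exact div_le_div_of_nonneg_right (by linarith) h.1.le

theorem expectedCount_nonneg (h0 : LaplaceFinite ρ 0) (n : ℕ) (y : ℝ) :
    0 ≤ expectedCount ρ n y := by
  refine ge_of_tendsto (tendsto_one_sub_iterate_branch_stepFun h0 n y) ?_
  filter_upwards [Ioo_mem_nhdsGT one_pos] with γ h
  have := ((isSubCDF_stepFun h.1.le h.2.le).iterate_branch (ρ := ρ) n).le_one y
  exact div_nonneg (by linarith) h.1.le

theorem expectedCount_le (h0 : LaplaceFinite ρ 0) (n : ℕ) (y : ℝ) :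
    expectedCount ρ n y ≤ laplace ρ 0 ^ n := by
  refine le_of_tendsto (tendsto_one_sub_iterate_branch_stepFun h0 n y) ?_
  filter_upwards [Ioo_mem_nhdsGT one_pos] with γ h
  have hs := isSubCDF_stepFun h.1.le h.2.le
  have := hs.one_sub_iterate_branch_le h0 (C := γ) (fun x => by
    unfold stepFun; split_ifs <;> simp [h.1.le]) n y
  rw [div_le_iff₀ h.1]
  simpa [mul_comm] using this

theorem integrable_sum_expectedCount (h0 : LaplaceFinite ρ 0) (n : ℕ) (y : ℝ) :
    Integrable (fun z : Offspring => ∑ k ∈ Finset.range z.1, expectedCount ρ n (y - z.2 k)) ρ := by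
  refine Integrable.mono' (h0.const_mul (laplace ρ 0 ^ n))
    (measurable_sum_range_offspring (f := fun x => expectedCount ρ n (y - x))
      ((antitone_expectedCount h0 n).measurable.comp
        (measurable_const.sub measurable_id))).aestronglyMeasurable
    (.of_forall fun z => ?_)
  rw [Real.norm_of_nonneg (Finset.sum_nonneg fun k _ => expectedCount_nonneg h0 n _)]
  refine (Finset.sum_le_sum fun k _ => expectedCount_le h0 n _).trans (le_of_eq ?_)
  simp [expSum_zero]; ring

/-- Exponential lower bounds for the indicator of a half-line propagate along the generations,
because exponentials are eigenfunctions of the linearised branching operator. -/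
theorem le_expectedCount (h0 : LaplaceFinite ρ 0) {t₀ t₁ t₂ c₀ c₁ c₂ : ℝ}
    (ht₀ : LaplaceFinite ρ t₀) (ht₁ : LaplaceFinite ρ t₁) (ht₂ : LaplaceFinite ρ t₂)
    (h : ∀ y, c₀ * Real.exp (-t₀ * y) - c₁ * Real.exp (-t₁ * y) - c₂ * Real.exp (-t₂ * y) ≤
      Set.indicator (Set.Iic 0) 1 y) (n : ℕ) (y : ℝ) :
    c₀ * laplace ρ t₀ ^ n * Real.exp (-t₀ * y) - c₁ * laplace ρ t₁ ^ n * Real.exp (-t₁ * y)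
      - c₂ * laplace ρ t₂ ^ n * Real.exp (-t₂ * y) ≤ expectedCount ρ n y := by
  induction n generalizing y with
  | zero => simp only [pow_zero, mul_one]; exact h y
  | succ n ih =>
    rw [expectedCount_succ]
    have hi : ∀ {t : ℝ}, LaplaceFinite ρ t → ∀ c : ℝ,
        Integrable (fun z => c * laplace ρ t ^ n * (Real.exp (-t * y) * expSum t z)) ρ :=
      fun ht c => (ht.const_mul _).const_mul _
    have he : ∀ t c : ℝ, c * laplace ρ t ^ (n + 1) * Real.exp (-t * y) =
        ∫ z, c * laplace ρ t ^ n * (Real.exp (-t * y) * expSum t z) ∂ρ := by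
      intro t c
      rw [integral_const_mul, integral_const_mul, ← laplace]; ring
    rw [he, he, he, ← integral_sub' (hi ht₀ c₀) (hi ht₁ c₁),
      ← integral_sub' ((hi ht₀ c₀).sub (hi ht₁ c₁)) (hi ht₂ c₂)]
    refine integral_mono (((hi ht₀ c₀).sub (hi ht₁ c₁)).sub (hi ht₂ c₂))
      (integrable_sum_expectedCount h0 n y) fun z => ?_
    simp only [Pi.sub_apply, ← expSum_shift, Finset.mul_sum, ← Finset.sum_sub_distrib]
    exact Finset.sum_le_sum fun k _ => ih _

theorem eventually_lt_of_hasDerivAt_neg {φ : ℝ → ℝ} {d : ℝ} (h : HasDerivAt φ d 0) (hd : d < 0) :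
    ∀ᶠ s in 𝓝[>] 0, φ s < φ 0 := by
  have h1 : Tendsto (slope φ 0) (𝓝[>] 0) (𝓝 d) :=
    (hasDerivAt_iff_tendsto_slope.1 h).mono_left
      (nhdsWithin_mono _ fun x hx => (Set.mem_Ioi.1 hx).ne')
  filter_upwards [h1.eventually (gt_mem_nhds hd), self_mem_nhdsWithin] with s hs hpos
  rw [slope_def_field, sub_zero, div_lt_iff₀ hpos, zero_mul] at hs
  linarith

theorem tendsto_pow_sub_pow_sub_pow {p q r : ℝ} (hp : 1 < p) (hq0 : 0 ≤ q) (hq : q < p)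
    (hr0 : 0 ≤ r) (hr : r < p) :
    Tendsto (fun n : ℕ => p ^ n - q ^ n - r ^ n) atTop atTop := by
  have hp0 : 0 < p := by linarith
  have h1 := tendsto_pow_atTop_atTop_of_one_lt hp
  have h2 := tendsto_pow_atTop_nhds_zero_of_lt_one (div_nonneg hq0 hp0.le) ((div_lt_one hp0).2 hq)
  have h3 := tendsto_pow_atTop_nhds_zero_of_lt_one (div_nonneg hr0 hp0.le) ((div_lt_one hp0).2 hr)
  have h4 := h1.atTop_mul_pos (C := 1) one_pos
    (by simpa using (tendsto_const_nhds (x := (1 : ℝ))).sub h2 |>.sub h3)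
  refine h4.congr fun n => ?_
  rw [div_pow, div_pow]
  have : p ^ n ≠ 0 := (pow_pos hp0 n).ne'
  field_simp

/-- At every speed below `ν'(t)`, with `ν(t) > t ν'(t)`, some generation contains more than one
particle in expectation. The exponential weight `e^{t S}` concentrates, in generation `n`, on the
positions between `n a` and `n b`, when `a < ν'(t) < b`. -/
theorem exists_one_lt_expectedCount (hsurv : ρ {z | z.1 = 0} = 0) (h0 : LaplaceFinite ρ 0)
    {T t a : ℝ} (hT : LaplaceFinite ρ T) (hT' : Integrable (weightedExpSum T) ρ) (ht : 0 < t)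
    (htT : t < T) (hgr : 0 < growthRate ρ t) (ha : a < laplaceDeriv ρ t / laplace ρ t) :
    ∃ n : ℕ, 1 ≤ n ∧ 1 < expectedCount ρ n (n * a) := by
  have hfin : ∀ s, 0 ≤ s → s ≤ T → LaplaceFinite ρ s := fun s => h0.of_le hT
  set m := laplace ρ with hm
  have hmt : 0 < m t := laplace_pos hsurv (hfin t ht.le htT.le)
  have hd := hasDerivAt_laplace h0 hT hT' ht htT
  have hgr' : laplaceDeriv ρ t / m t < Real.log (m t) / t := by
    rw [div_lt_div_iff₀ hmt ht]
    unfold growthRate at hgr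
    linarith
  obtain ⟨b, hb1, hb2⟩ := exists_between hgr'
  have hab : a < b := ha.trans hb1
  have hleft : ∀ᶠ s in 𝓝[>] (0 : ℝ), Real.exp (s * a) * m (t - s) < m t := by
    have h1 : HasDerivAt (fun s : ℝ => Real.exp (s * a) * m (t - s))
        (a * m t - laplaceDeriv ρ t) 0 := by
      have e1 : HasDerivAt (fun s : ℝ => Real.exp (s * a)) a 0 := by
        simpa using ((hasDerivAt_id (0 : ℝ)).mul_const a).exp
      have e2 : HasDerivAt (fun s : ℝ => m (t - s)) (-laplaceDeriv ρ t) 0 := by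
        have hd' : HasDerivAt m (laplaceDeriv ρ t) (t - 0) := by simpa using hd
        simpa using hd'.comp_const_sub t 0
      have := e1.fun_mul e2
      simpa [sub_eq_add_neg] using this
    have := eventually_lt_of_hasDerivAt_neg h1 (by rw [lt_div_iff₀ hmt] at ha; linarith)
    simpa using this
  have hright : ∀ᶠ s in 𝓝[>] (0 : ℝ), Real.exp (-s * b) * m (t + s) < m t := by
    have h1 : HasDerivAt (fun s : ℝ => Real.exp (-s * b) * m (t + s))
        (-b * m t + laplaceDeriv ρ t) 0 := by
      have e1 : HasDerivAt (fun s : ℝ => Real.exp (-s * b)) (-b) 0 := by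
        simpa using ((hasDerivAt_id (0 : ℝ)).neg.mul_const b).exp
      have e2 : HasDerivAt (fun s : ℝ => m (t + s)) (laplaceDeriv ρ t) 0 := by
        have hd' : HasDerivAt m (laplaceDeriv ρ t) (t + 0) := by simpa using hd
        exact hd'.comp_const_add t 0
      have := e1.fun_mul e2
      simpa using this
    have := eventually_lt_of_hasDerivAt_neg h1 (by rw [div_lt_iff₀ hmt] at hb1; linarith)
    simpa using this
  have hsmall : ∀ᶠ s in 𝓝[>] (0 : ℝ), s ∈ Set.Ioo 0 (min t (T - t)) :=
    Ioo_mem_nhdsGT (lt_min ht (by linarith))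
  obtain ⟨s, ⟨hs1, hs2⟩, hs0, hs3⟩ := ((hleft.and hright).and hsmall).exists
  have hst : s < t := hs3.trans_le (min_le_left _ _)
  have hsT : t + s < T := by have := hs3.trans_le (min_le_right _ _); linarith
  have hF1 := hfin (t - s) (by linarith) (by linarith)
  have hF2 := hfin (t + s) (by linarith) hsT.le
  have hE : 0 < Real.exp (-t * b) := Real.exp_pos _
  have hp : 1 < Real.exp (-t * b) * m t := by
    rw [lt_div_iff₀ ht] at hb2
    have : Real.exp (b * t) < m t := by
      rw [← Real.exp_log hmt]; exact Real.exp_lt_exp.2 hb2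
    calc (1 : ℝ) = Real.exp (-t * b) * Real.exp (b * t) := by
          rw [← Real.exp_add]; ring_nf; simp
      _ < _ := by gcongr
  have hlim := tendsto_pow_sub_pow_sub_pow hp
    (q := Real.exp (-t * b) * (Real.exp (s * a) * m (t - s)))
    (r := Real.exp (-t * b) * (Real.exp (-s * b) * m (t + s)))
    (mul_nonneg hE.le (mul_nonneg (Real.exp_pos _).le (laplace_pos hsurv hF1).le))
    (by gcongr) (mul_nonneg hE.le (mul_nonneg (Real.exp_pos _).le (laplace_pos hsurv hF2).le))
    (by gcongr)
  obtain ⟨n, hn, hn1⟩ := ((hlim.eventually_gt_atTop 1).and (eventually_ge_atTop 1)).exists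
  refine ⟨n, hn1, hn.trans_le ?_⟩
  set D : ℝ := n * (b - a) with hD
  have hD0 : 0 ≤ D := mul_nonneg (Nat.cast_nonneg n) (by linarith)
  -- With `S = n a - y`, the indicator of `S ≥ n a` is bounded below by
  -- `e^{t (S - n b)} (1 - e^{-s (S - n a)} - e^{s (S - n b)})`.
  have hind : ∀ y : ℝ, Real.exp (-t * D) * Real.exp (-t * y)
      - Real.exp (-t * D) * Real.exp (-(t - s) * y)
      - Real.exp (-(t + s) * D) * Real.exp (-(t + s) * y) ≤ Set.indicator (Set.Iic 0) 1 y := by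
    intro y
    have e1 : Real.exp (-t * D) * Real.exp (-(t - s) * y) =
        Real.exp (-t * D) * Real.exp (-t * y) * Real.exp (s * y) := by
      rw [← Real.exp_add, ← Real.exp_add, ← Real.exp_add]; ring_nf
    have e2 : Real.exp (-(t + s) * D) * Real.exp (-(t + s) * y) =
        Real.exp (-t * D) * Real.exp (-t * y) * Real.exp (-s * (y + D)) := by
      rw [← Real.exp_add, ← Real.exp_add, ← Real.exp_add]; ring_nf
    rw [e1, e2]
    set w := Real.exp (-t * D) * Real.exp (-t * y) with hw
    have hw0 : 0 < w := by positivity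
    have g1 := Real.exp_pos (s * y)
    have g2 := Real.exp_pos (-s * (y + D))
    simp only [Set.indicator, Set.mem_Iic, Pi.one_apply]
    split_ifs with hy
    · rcases le_total (-D) y with h | h
      · have : w ≤ 1 := by
          rw [hw, ← Real.exp_add]; apply Real.exp_le_one_iff.2; nlinarith
        nlinarith [mul_pos hw0 g1, mul_pos hw0 g2]
      · have : 1 ≤ Real.exp (-s * (y + D)) := Real.one_le_exp (by nlinarith)
        nlinarith [mul_pos hw0 g1]
    · have : 1 ≤ Real.exp (s * y) := Real.one_le_exp (by nlinarith)
      nlinarith [mul_pos hw0 g2]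
  have hmain := le_expectedCount h0 (hfin t ht.le htT.le) hF1 hF2 hind n (n * a)
  refine le_trans (le_of_eq ?_) hmain
  have e : ∀ u v : ℝ, Real.exp u ^ n * v = Real.exp (n * u) * v := by
    intro u v; rw [Real.exp_nat_mul]
  have c0 : (Real.exp (-t * b) * m t) ^ n =
      Real.exp (-t * D) * m t ^ n * Real.exp (-t * (n * a)) := by
    rw [mul_pow, e, mul_right_comm, ← Real.exp_add, hD]; ring_nf
  have c1 : (Real.exp (-t * b) * (Real.exp (s * a) * m (t - s))) ^ n =
      Real.exp (-t * D) * m (t - s) ^ n * Real.exp (-(t - s) * (n * a)) := by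
    rw [← mul_assoc, ← Real.exp_add, mul_pow, e, mul_right_comm _ _ (Real.exp _), ← Real.exp_add,
      hD]
    ring_nf
  have c2 : (Real.exp (-t * b) * (Real.exp (-s * b) * m (t + s))) ^ n =
      Real.exp (-(t + s) * D) * m (t + s) ^ n * Real.exp (-(t + s) * (n * a)) := by
    rw [← mul_assoc, ← Real.exp_add, mul_pow, e, mul_right_comm _ _ (Real.exp _), ← Real.exp_add,
      hD]
    ring_nf
  rw [c0, c1, c2]

/-! ### Tails of the iterates of the branching operator -/

theorem IsSubCDF.iterate_branch_lt_one (hsurv : ρ {z | z.1 = 0} = 0) (hf : IsSubCDF f)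
    (hlt : ∀ x, f x < 1) (n : ℕ) (x : ℝ) : (PerturbedBRW.branch ρ)^[n] f x < 1 := by
  induction n generalizing x with
  | zero => exact hlt x
  | succ n ih =>
    rw [Function.iterate_succ_apply']
    have hn := hf.iterate_branch (ρ := ρ) n
    set F := (PerturbedBRW.branch ρ)^[n] f
    have hi : Integrable (fun z : Offspring =>
        1 - ∏ k ∈ Finset.range z.1, F (x - z.2 k)) ρ :=
      (integrable_const _).sub (hn.integrable_prod x)
    have hnn : ∀ z : Offspring, 0 ≤ 1 - ∏ k ∈ Finset.range z.1, F (x - z.2 k) := fun z =>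
      sub_nonneg.2 (hn.prod_le_one x z)
    have h0 : 0 ≤ ∫ z, (1 - ∏ k ∈ Finset.range z.1, F (x - z.2 k)) ∂ρ := integral_nonneg hnn
    have h1 : ∫ z, (1 - ∏ k ∈ Finset.range z.1, F (x - z.2 k)) ∂ρ =
        1 - PerturbedBRW.branch ρ F x := by
      rw [integral_sub (integrable_const _) (hn.integrable_prod x)]
      simp [PerturbedBRW.branch]
    rcases h0.lt_or_eq with h | h
    · linarith
    · exfalso
      have hz := (integral_eq_zero_iff_of_nonneg hnn hi).1 h.symm
      obtain ⟨z, hz1, hz2⟩ := (hz.and (ae_one_le_offspring hsurv)).exists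
      obtain ⟨N, hN⟩ : ∃ N, z.1 = N + 1 := ⟨z.1 - 1, by omega⟩
      simp only [Pi.zero_apply, hN, Finset.prod_range_succ'] at hz1
      have hP : ∏ k ∈ Finset.range N, F (x - z.2 (k + 1)) ≤ 1 :=
        Finset.prod_le_one (fun _ _ => hn.nonneg _) fun _ _ => hn.le_one _
      nlinarith [ih (x - z.2 0), hn.nonneg (x - z.2 0)]

/-- If some generation `K` has more than one particle beyond `K a` in expectation, then with
probability bounded below, whatever `n` is, generation `n` reaches `n a`. This is the survival of a
supercritical Galton–Watson process, seen through its generating function: the slope at `1` of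
the generating function of the number of particles beyond `K a` exceeds `1`, so that a small `γ` is
reproduced from one block of `K` generations to the next. -/
theorem IsSubCDF.exists_iterate_branch_le (hsurv : ρ {z | z.1 = 0} = 0)
    (h0 : LaplaceFinite ρ 0) (hf : IsSubCDF f) (hlt : ∀ x, f x < 1) {K : ℕ} (hK : 1 ≤ K) {a : ℝ}
    (hcount : 1 < expectedCount ρ K (K * a)) :
    ∃ γ ∈ Set.Ioo (0 : ℝ) 1, ∀ n : ℕ, (PerturbedBRW.branch ρ)^[n] f (n * a) ≤ 1 - γ := by
  have h1 : ∀ᶠ γ : ℝ in 𝓝[>] 0, ∀ r ∈ Finset.range K,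
      γ < 1 - (PerturbedBRW.branch ρ)^[r] f (r * a) := by
    rw [Finset.eventually_all]
    intro r _
    have := hf.iterate_branch_lt_one hsurv hlt r (r * a)
    exact (gt_mem_nhds (by linarith)).filter_mono nhdsWithin_le_nhds
  have h2 := (tendsto_one_sub_iterate_branch_stepFun h0 K (K * a)).eventually (lt_mem_nhds hcount)
  obtain ⟨γ, ⟨h1, h2⟩, hγ⟩ := ((h1.and h2).and (Ioo_mem_nhdsGT one_pos)).exists
  refine ⟨γ, hγ, fun n => ?_⟩
  rw [lt_div_iff₀ hγ.1, one_mul] at h2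
  induction n using Nat.strong_induction_on with
  | _ n ih =>
    rcases lt_or_ge n K with hnK | hnK
    · linarith [h1 n (Finset.mem_range.2 hnK)]
    · obtain ⟨j, rfl⟩ := Nat.exists_eq_add_of_le hnK
      have hj := ih j (by omega)
      have hj' := hf.iterate_branch (ρ := ρ) j
      rw [Function.iterate_add_apply]
      have := hj'.iterate_branch_le (ρ := ρ) (isSubCDF_stepFun hγ.1.le hγ.2.le) (c := j * a)
        (fun y => by
          unfold stepFun
          split_ifs with hy
          · exact (hj'.mono (by linarith)).trans hj
          · exact hj'.le_one y) K ((K + j : ℕ) * a)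
      have e : ((K + j : ℕ) : ℝ) * a - j * a = K * a := by push_cast; ring
      rw [e] at this
      linarith

theorem integral_pow_lt_one (hsurv : ρ {z | z.1 = 0} = 0) (h1 : ¬ ∀ᵐ z ∂ρ, z.1 = 1) {q : ℝ}
    (hq0 : 0 ≤ q) (hq1 : q < 1) :
    Integrable (fun z : Offspring => q ^ (z.1 - 1)) ρ ∧ ∫ z, q ^ (z.1 - 1) ∂ρ < 1 := by
  have hmeas : Measurable fun z : Offspring => q ^ (z.1 - 1) :=
    (Measurable.of_discrete (f := fun n : ℕ => q ^ (n - 1))).comp measurable_fst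
  have hle : ∀ z : Offspring, q ^ (z.1 - 1) ≤ 1 := fun z => pow_le_one₀ hq0 hq1.le
  have hi : Integrable (fun z : Offspring => q ^ (z.1 - 1)) ρ :=
    Integrable.of_bound hmeas.aestronglyMeasurable 1 (.of_forall fun z => by
      rw [Real.norm_of_nonneg (pow_nonneg hq0 _)]; exact hle z)
  refine ⟨hi, ?_⟩
  have hnn : ∀ z : Offspring, 0 ≤ 1 - q ^ (z.1 - 1) := fun z => sub_nonneg.2 (hle z)
  have he : ∫ z, (1 - q ^ (z.1 - 1)) ∂ρ = 1 - ∫ z, q ^ (z.1 - 1) ∂ρ := by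
    rw [integral_sub (integrable_const _) hi]; simp
  have h0 : 0 ≤ ∫ z, (1 - q ^ (z.1 - 1)) ∂ρ := integral_nonneg hnn
  rcases h0.lt_or_eq with h | h
  · linarith
  · refine absurd ?_ h1
    have hz := (integral_eq_zero_iff_of_nonneg hnn ((integrable_const _).sub hi)).1 h.symm
    filter_upwards [hz, ae_one_le_offspring hsurv] with z hz hz1
    by_contra hne
    have : q ^ (z.1 - 1) < 1 := pow_lt_one₀ hq0 hq1 (by omega)
    simp only [Pi.zero_apply] at hz
    linarith

/-- From a positive probability to a probability close to `1`: after `l` generations there are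
many particles, none of them far to the left, and each starts an independent attempt. The first
term bounds the probability that all attempts fail, the second that some particle is too far to the
left. -/
theorem IsSubCDF.iterate_branch_le_pow_add (hsurv : ρ {z | z.1 = 0} = 0) (hf : IsSubCDF f)
    {q c τ : ℝ} (hq0 : 0 ≤ q) (hq1 : q < 1) (h1 : ¬ ∀ᵐ z ∂ρ, z.1 = 1) (hc : f c ≤ q) (hτ : 0 < τ)
    (hL : LaplaceFinite ρ (-τ)) (l : ℕ) (y : ℝ) :
    (PerturbedBRW.branch ρ)^[l] f y ≤ (∫ z, q ^ (z.1 - 1) ∂ρ) ^ l * q +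
      laplace ρ (-τ) ^ l * Real.exp (τ * (y - c)) := by
  obtain ⟨hκi, hκ1⟩ := integral_pow_lt_one hsurv h1 hq0 hq1
  set κ := ∫ z, q ^ (z.1 - 1) ∂ρ
  have hκ0 : 0 ≤ κ := integral_nonneg fun z => pow_nonneg hq0 _
  have hM : 0 < laplace ρ (-τ) := laplace_pos hsurv hL
  induction l generalizing y with
  | zero =>
    simp only [Function.iterate_zero, id, pow_zero, one_mul]
    rcases le_total y c with h | h
    · linarith [hf.mono h, Real.exp_pos (τ * (y - c))]
    · have : 1 ≤ Real.exp (τ * (y - c)) := Real.one_le_exp (by nlinarith)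
      linarith [hf.le_one y]
  | succ l ih =>
    rw [Function.iterate_succ_apply']
    have hl := hf.iterate_branch (ρ := ρ) l
    set F := (PerturbedBRW.branch ρ)^[l] f
    set A := κ ^ l * q with hA
    set M := laplace ρ (-τ)
    have hκl : κ ^ l ≤ 1 := pow_le_one₀ hκ0 hκ1.le
    have hA0 : 0 ≤ A := mul_nonneg (pow_nonneg hκ0 l) hq0
    have hAq : A ≤ q := mul_le_of_le_one_left hq0 hκl
    have hi1 : Integrable (fun z : Offspring => A * q ^ (z.1 - 1)) ρ := hκi.const_mul A
    have hi2 : Integrable (fun z : Offspring =>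
        M ^ l * Real.exp (-(τ * c)) * (Real.exp (-(-τ) * y) * expSum (-τ) z)) ρ :=
      (hL.const_mul _).const_mul _
    have hval : κ ^ (l + 1) * q + M ^ (l + 1) * Real.exp (τ * (y - c)) =
        ∫ z, (A * q ^ (z.1 - 1) +
          M ^ l * Real.exp (-(τ * c)) * (Real.exp (-(-τ) * y) * expSum (-τ) z)) ∂ρ := by
      rw [integral_add hi1 hi2, integral_const_mul, integral_const_mul, integral_const_mul,
        ← laplace, mul_sub, Real.exp_sub, Real.exp_neg, neg_neg]
      change κ ^ (l + 1) * q + M ^ (l + 1) * _ = κ ^ l * q * κ + M ^ l * _ * (_ * M)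
      field_simp
      ring
    rw [hval]
    refine integral_mono_ae (hl.integrable_prod y) (hi1.add hi2) ?_
    filter_upwards [ae_one_le_offspring hsurv] with z hz
    refine (prod_range_le_pow_add_sum hA0 (hAq.trans hq1.le) (fun k => hl.nonneg _)
      (fun k => hl.le_one _) (b := fun k => M ^ l * Real.exp (τ * (y - z.2 k - c)))
      (fun k => mul_nonneg (pow_nonneg hM.le l) (Real.exp_pos _).le) (fun k => ih _) z.1).trans ?_
    refine add_le_add ?_ (le_of_eq ?_)
    · obtain ⟨N, hN⟩ : ∃ N, z.1 = N + 1 := ⟨z.1 - 1, by omega⟩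
      rw [hN, pow_succ', Nat.add_sub_cancel]
      gcongr
    · rw [← expSum_shift, Finset.mul_sum]
      refine Finset.sum_congr rfl fun k _ => ?_
      rw [mul_assoc, ← Real.exp_add]; ring_nf

theorem summable_pow_div {κ : ℝ} (h0 : 0 ≤ κ) (h1 : κ < 1) {d : ℕ} (hd : d ≠ 0) :
    Summable fun n : ℕ => κ ^ (n / d) := by
  set κ' := max κ (1 / 2) with hκ'
  have h0' : 0 < κ' := lt_max_of_lt_right (by norm_num)
  have h1' : κ' < 1 := max_lt h1 (by norm_num)
  set r := κ' ^ ((d : ℝ)⁻¹) with hr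
  have hr0 : 0 ≤ r := Real.rpow_nonneg h0'.le _
  have hr1 : r < 1 := Real.rpow_lt_one h0'.le h1' (by positivity)
  have hrd : r ^ d = κ' := Real.rpow_inv_natCast_pow h0'.le hd
  refine Summable.of_nonneg_of_le (fun n => pow_nonneg h0 _) (fun n => ?_)
    ((summable_geometric_of_lt_one hr0 hr1).mul_left κ'⁻¹)
  calc κ ^ (n / d) ≤ κ' ^ (n / d) := pow_le_pow_left₀ h0 (le_max_left _ _) _
    _ = κ'⁻¹ * r ^ (d * (n / d + 1)) := by rw [pow_mul, hrd, pow_succ]; field_simp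
    _ ≤ κ'⁻¹ * r ^ n := by
        refine mul_le_mul_of_nonneg_left (pow_le_pow_of_le_one hr0 hr1.le ?_) (by positivity)
        exact (Nat.lt_mul_div_succ n (Nat.pos_of_ne_zero hd)).le

theorem IsSubCDF.summable_iterate_branch (hsurv : ρ {z | z.1 = 0} = 0) (hf : IsSubCDF f)
    (h1 : ¬ ∀ᵐ z ∂ρ, z.1 = 1) {γ a x τ : ℝ} (hγ : γ ∈ Set.Ioo (0 : ℝ) 1)
    (hn : ∀ n : ℕ, (PerturbedBRW.branch ρ)^[n] f (n * a) ≤ 1 - γ) (hτ : 0 < τ)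
    (hL : LaplaceFinite ρ (-τ)) (hx : x < a) :
    Summable fun n : ℕ => (PerturbedBRW.branch ρ)^[n] f (n * x) := by
  have hq0 : 0 ≤ 1 - γ := by linarith [hγ.2]
  have hq1 : 1 - γ < 1 := by linarith [hγ.1]
  obtain ⟨hκi, hκ1⟩ := integral_pow_lt_one hsurv h1 hq0 hq1
  have hκ0 : 0 ≤ ∫ z, (1 - γ) ^ (z.1 - 1) ∂ρ := integral_nonneg fun z => pow_nonneg hq0 _
  have hM : 0 < laplace ρ (-τ) := laplace_pos hsurv hL
  set κ := ∫ z, (1 - γ) ^ (z.1 - 1) ∂ρ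
  set M := laplace ρ (-τ) with hMdef
  -- Out of `n` generations, the first `n / d` serve to produce independent starting points;
  -- `d` is so large that the loss `n (a - x) / 2` outweighs their leftward displacement.
  set D := τ * (a - x) with hD
  have hDpos : 0 < D := mul_pos hτ (by linarith)
  set B := |Real.log M + τ * a| with hB
  obtain ⟨d, hd⟩ := exists_nat_gt (2 * B / D)
  have hB0 : 0 ≤ B := abs_nonneg _
  have hdpos : (0 : ℝ) < d := lt_of_le_of_lt (by positivity) hd
  have hd0 : d ≠ 0 := by rintro rfl; simp at hdpos
  rw [div_lt_iff₀ hDpos] at hd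
  have hr1 : Real.exp (-(D / 2)) < 1 := Real.exp_lt_one_iff.2 (by linarith)
  refine Summable.of_nonneg_of_le (fun n => (hf.iterate_branch n).nonneg _) (fun n => ?_)
    (((summable_pow_div hκ0 hκ1 hd0).mul_right (1 - γ)).add
      (summable_geometric_of_lt_one (Real.exp_pos (-(D / 2))).le hr1))
  set l := n / d with hl
  have hln : l ≤ n := Nat.div_le_self n d
  have hld : (l : ℝ) * d ≤ n := by exact_mod_cast Nat.div_mul_le_self n d
  have key := (hf.iterate_branch (ρ := ρ) (n - l)).iterate_branch_le_pow_add hsurv hq0 hq1 h1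
    (hn (n - l)) hτ hL l (n * x)
  rw [← Function.iterate_add_apply, Nat.add_sub_cancel' hln] at key
  refine key.trans (add_le_add le_rfl ?_)
  have hMl : M ^ l = Real.exp (l * Real.log M) := by rw [Real.exp_nat_mul, Real.exp_log hM]
  rw [← hMdef, hMl, ← Real.exp_add, ← Real.exp_nat_mul, Real.exp_le_exp, Nat.cast_sub hln]
  have hl0 : (0 : ℝ) ≤ l := Nat.cast_nonneg l
  have e1 : (l : ℝ) * (Real.log M + τ * a) ≤ l * B :=
    mul_le_mul_of_nonneg_left (le_abs_self _) hl0
  have e2 : (l : ℝ) * (2 * B) ≤ n * D := by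
    have := mul_le_mul_of_nonneg_left hd.le hl0
    nlinarith
  rw [hD] at e2 ⊢
  linarith

theorem IsSubCDF.summable_one_sub_iterate_branch (hsurv : ρ {z | z.1 = 0} = 0) (hf : IsSubCDF f)
    {t C x : ℝ} (ht : 0 < t) (hL : LaplaceFinite ρ t)
    (h : ∀ y, 1 - f y ≤ C * Real.exp (-t * y)) (hx : Real.log (laplace ρ t) / t < x) :
    Summable fun n : ℕ => 1 - (PerturbedBRW.branch ρ)^[n] f (n * x) := by
  have hm : 0 < laplace ρ t := laplace_pos hsurv hL
  have hr : laplace ρ t * Real.exp (-t * x) < 1 := by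
    rw [div_lt_iff₀ ht] at hx
    nth_rewrite 1 [← Real.exp_log hm]
    rw [← Real.exp_add]
    exact Real.exp_lt_one_iff.2 (by linarith)
  refine Summable.of_nonneg_of_le (fun n => sub_nonneg.2 ((hf.iterate_branch n).le_one _))
    (fun n => ?_) ((summable_geometric_of_lt_one (by positivity) hr).mul_left C)
  refine (hf.one_sub_iterate_branch_le hL h n (n * x)).trans (le_of_eq ?_)
  rw [mul_pow, ← Real.exp_nat_mul]; ring_nf

/-- The summability of both deviation probabilities, for every initial function `f` with
`f < 1` whose right tail is `O(e^{-t x})` for each `t` below the critical parameter. -/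
theorem IsSubCDF.summable_deviations (hsurv : ρ {z | z.1 = 0} = 0)
    (hfin : ∃ a b : ℝ, a < 0 ∧ 0 < b ∧ ∀ t ∈ Set.Ioo a b, LaplaceFinite ρ t)
    {θ₀ : ℝ} (hθ₀ : criticalParam ρ = (θ₀ : EReal)) (hθ₀_pos : 0 < θ₀)
    (hf : IsSubCDF f) (hlt : ∀ x, f x < 1)
    (htail : ∀ t, 0 < t → t < θ₀ → ∃ C, ∀ y, 1 - f y ≤ C * Real.exp (-t * y)) :
    (∀ x, nu ρ θ₀ / θ₀ < x →
      Summable fun n : ℕ => 1 - (PerturbedBRW.branch ρ)^[n] f (n * x)) ∧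
    (∀ x, x < nu ρ θ₀ / θ₀ → Summable fun n : ℕ => (PerturbedBRW.branch ρ)^[n] f (n * x)) := by
  obtain ⟨α, β, hα, hβ, hfin⟩ := hfin
  have h0 : LaplaceFinite ρ 0 := hfin 0 ⟨hα, hβ⟩
  have hmem := criticalParam_mem_criticalSet hsurv h0 hθ₀ hθ₀_pos
  have hm : 0 < laplace ρ θ₀ := laplace_pos hsurv hmem.2.1
  have hev : ∀ᶠ t in 𝓝[<] θ₀, t ∈ Set.Ioo (θ₀ / 2) θ₀ := Ioo_mem_nhdsLT (by linarith)
  have hle : 𝓝[<] θ₀ ≤ 𝓝[Set.Icc (θ₀ / 2) θ₀] θ₀ :=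
    nhdsWithin_le_iff.2 (mem_of_superset (Ioo_mem_nhdsLT (by linarith)) Set.Ioo_subset_Icc_self)
  have hself : θ₀ ∈ Set.Icc (θ₀ / 2) θ₀ := ⟨by linarith, le_rfl⟩
  have hc1 : Tendsto (laplace ρ) (𝓝[<] θ₀) (𝓝 (laplace ρ θ₀)) :=
    (((continuousOn_laplace h0 hmem.2.1).mono
      (Set.Icc_subset_Icc_left (by linarith))) θ₀ hself).tendsto.mono_left hle
  have hc2 : Tendsto (laplaceDeriv ρ) (𝓝[<] θ₀) (𝓝 (laplaceDeriv ρ θ₀)) :=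
    ((continuousOn_laplaceDeriv h0 hmem.2.2.1 (by linarith)) θ₀ hself).tendsto.mono_left hle
  constructor
  · intro x hx
    have hlim : Tendsto (fun t => Real.log (laplace ρ t) / t) (𝓝[<] θ₀) (𝓝 (nu ρ θ₀ / θ₀)) :=
      (hc1.log hm.ne').div (tendsto_id'.2 nhdsWithin_le_nhds) hθ₀_pos.ne'
    obtain ⟨t, ht1, ht2⟩ := ((hlim.eventually (gt_mem_nhds hx)).and hev).exists
    have ht0 : 0 < t := by linarith [ht2.1]
    obtain ⟨C, hC⟩ := htail t ht0 ht2.2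
    exact hf.summable_one_sub_iterate_branch hsurv ht0 (h0.of_le hmem.2.1 ht0.le ht2.2.le) hC ht1
  · intro x hx
    have hlim : Tendsto (fun t => laplaceDeriv ρ t / laplace ρ t) (𝓝[<] θ₀)
        (𝓝 (nu ρ θ₀ / θ₀)) := by
      have e : nu ρ θ₀ / θ₀ = laplaceDeriv ρ θ₀ / laplace ρ θ₀ := by
        have := (mem_criticalSet_iff hsurv hmem.1 hmem.2.1 hmem.2.2.1).1 hmem
        rw [growthRate] at this
        rw [div_eq_div_iff hθ₀_pos.ne' hm.ne']
        change Real.log (laplace ρ θ₀) * _ = _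
        linarith
      rw [e]
      exact hc2.div hc1 hm.ne'
    obtain ⟨a, hxa, ha⟩ := exists_between hx
    obtain ⟨t, ht1, ht2⟩ := ((hlim.eventually (lt_mem_nhds ha)).and hev).exists
    have ht0 : 0 < t := by linarith [ht2.1]
    obtain ⟨K, hK, hcount⟩ := exists_one_lt_expectedCount hsurv h0 hmem.2.1 hmem.2.2.1 ht0 ht2.2
      (growthRate_pos hsurv h0 hθ₀ hθ₀_pos ht0 ht2.2) ht1
    obtain ⟨γ, hγ, hn⟩ := hf.exists_iterate_branch_le hsurv h0 hlt hK hcount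
    exact hf.summable_iterate_branch hsurv (not_ae_eq_one hsurv h0 hθ₀ hθ₀_pos) hγ hn
      (τ := -α / 2) (by linarith) (hfin _ ⟨by linarith, by linarith⟩) hxa

end

/-! ### Independence -/

section

variable {Ω ι α β : Type*} [MeasurableSpace Ω] [MeasurableSpace α] [MeasurableSpace β]

theorem iIndepFun_prodMk {P : Measure Ω} [IsProbabilityMeasure P] {X : ι → Ω → α} {Y : ι → Ω → β}
    (mX : ∀ i, Measurable (X i)) (mY : ∀ i, Measurable (Y i)) (hX : iIndepFun X P)
    (hY : iIndepFun Y P) (hXY : IndepFun (fun ω i => X i ω) (fun ω i => Y i ω) P) :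
    iIndepFun (fun i ω => (X i ω, Y i ω)) P := by
  rw [iIndepFun_iff_finset] at hX hY ⊢
  intro s
  have := fun i : s => Measure.isProbabilityMeasure_map (μ := P) (mX i).aemeasurable
  have := fun i : s => Measure.isProbabilityMeasure_map (μ := P) (mY i).aemeasurable
  have hXs := (iIndepFun_iff_map_fun_eq_pi_map fun i : s => (mX i).aemeasurable).1 (hX s)
  have hYs := (iIndepFun_iff_map_fun_eq_pi_map fun i : s => (mY i).aemeasurable).1 (hY s)
  have mXs : Measurable fun ω (i : s) => X i ω := measurable_pi_iff.2 fun i => mX i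
  have mYs : Measurable fun ω (i : s) => Y i ω := measurable_pi_iff.2 fun i => mY i
  have hind : IndepFun (fun ω (i : s) => X i ω) (fun ω (i : s) => Y i ω) P :=
    hXY.comp (Finset.measurable_restrict s) (Finset.measurable_restrict s)
  have hprod := (indepFun_iff_map_prod_eq_prod_map_map mXs.aemeasurable mYs.aemeasurable).1 hind
  change iIndepFun (fun (i : s) ω => (X i ω, Y i ω)) P
  rw [iIndepFun_iff_map_fun_eq_pi_map fun i : s => ((mX i).prodMk (mY i)).aemeasurable]
  have hpair : ∀ i : s, P.map (fun ω => (X i ω, Y i ω)) = (P.map (X i)).prod (P.map (Y i)) :=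
    fun i => (indepFun_iff_map_prod_eq_prod_map_map (mX i).aemeasurable (mY i).aemeasurable).1
      (hXY.comp (measurable_pi_apply (i : ι)) (measurable_pi_apply (i : ι)))
  simp_rw [hpair]
  have hmp := (measurePreserving_arrowProdEquivProdArrow α β s (fun i => P.map (X i))
    fun i => P.map (Y i)).symm
  rw [← hmp.map_eq, ← hXs, ← hYs]
  erw [← hprod]
  rw [Measure.map_map hmp.measurable (mXs.prodMk mYs)]
  rfl

/-- A family indexed by words splits into its value at the root and the families carried by the
subtrees of the children of the root; these are independent. -/
theorem map_infinitePi_root_subtrees (m : Measure α) [IsProbabilityMeasure m] :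
    (Measure.infinitePi fun _ : List ℕ => m).map
        (fun w => (w [], fun (k : ℕ) (u : List ℕ) => w (u ++ [k]))) =
      m.prod (Measure.infinitePi fun _ : ℕ => Measure.infinitePi fun _ : List ℕ => m) := by
  set Q := Measure.infinitePi fun _ : List ℕ => m
  have hI : iIndepFun (fun (u : List ℕ) (w : List ℕ → α) => w u) Q :=
    iIndepFun_infinitePi (P := fun _ : List ℕ => m) (X := fun _ x => x) (fun _ => measurable_id)
  have hroot : Measurable fun w : List ℕ → α => w [] := measurable_pi_apply _
  have hsub : Measurable fun (w : List ℕ → α) (k : ℕ) (u : List ℕ) => w (u ++ [k]) := by fun_prop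
  have hind : IndepFun (fun w : List ℕ → α => w [])
      (fun (w : List ℕ → α) (k : ℕ) (u : List ℕ) => w (u ++ [k])) Q := by
    have h := indep_iSup_of_disjoint (fun u => (measurable_pi_apply (X := fun _ : List ℕ => α)
      u).comap_le) hI (S := {[]}) (T := {[]}ᶜ) disjoint_compl_right
    refine indep_of_indep_of_le_left (indep_of_indep_of_le_right h ?_) ?_
    · simp only [MeasurableSpace.pi, MeasurableSpace.comap_iSup, MeasurableSpace.comap_comp]
      exact iSup_le fun k => iSup_le fun u => le_iSup₂_of_le (u ++ [k]) (by simp) le_rfl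
    · exact le_iSup₂_of_le [] (by simp) le_rfl
  rw [(indepFun_iff_map_prod_eq_prod_map_map hroot.aemeasurable hsub.aemeasurable).1 hind]
  congr 1
  · exact Measure.infinitePi_map_eval _ _
  · have hinj : Function.Injective fun p : ℕ × List ℕ => p.2 ++ [p.1] := by
      rintro ⟨k, u⟩ ⟨l, v⟩ h
      obtain ⟨h1, h2⟩ := List.append_inj' h rfl
      simp_all
    have h1 := Measure.map_infinitePi_infinitePi_of_inj (P := fun _ : List ℕ => m) hinj
    have h2 := Measure.infinitePi_map_curry (fun (_ : ℕ) (_ : List ℕ) => m)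
    rw [← h2, ← h1, Measure.map_map (by fun_prop) (by fun_prop)]
    rfl

end

/-! ### The law of the rightmost perturbed position -/

section

/-- The data attached to a label `u`: the reproduction `Z u` and the pair `(Y u, E u)`. -/
abbrev Mark : Type := Offspring × (ℝ × ℝ)

theorem inTree_append_singleton (z : List ℕ → Offspring) (u : List ℕ) (k : ℕ) :
    InTree z (u ++ [k]) ↔ k < (z []).1 ∧ InTree (fun v => z (v ++ [k])) u := by
  induction u with
  | nil => simp [InTree]
  | cons j u ih => simp only [List.cons_append, InTree, ih, and_assoc]

theorem position_append_singleton (z : List ℕ → Offspring) (u : List ℕ) (k : ℕ) :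
    position z (u ++ [k]) = (z []).2 k + position (fun v => z (v ++ [k])) u := by
  induction u with
  | nil => simp [position]
  | cons j u ih => simp only [List.cons_append, position, ih, add_assoc]

/-- The event that all perturbed positions in generation `n` are less than `x`. -/
def below (θ : ℝ) (n : ℕ) (x : ℝ) : Set (List ℕ → Mark) :=
  {w | ∀ v ∈ generation (fun u => (w u).1) n,
    perturbedPosition θ (fun u => (w u).1) (fun v => (w v).2.1) (fun v => (w v).2.2) v < x}

theorem mem_below_succ {θ : ℝ} {n : ℕ} {x : ℝ} {w : List ℕ → Mark} :
    w ∈ below θ (n + 1) x ↔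
      ∀ k < (w []).1.1, (fun u => w (u ++ [k])) ∈ below θ n (x - (w []).1.2 k) := by
  constructor
  · rintro h k hk v ⟨hv, hvt⟩
    have := h (v ++ [k]) ⟨by simp [hv], (inTree_append_singleton _ _ _).2 ⟨hk, hvt⟩⟩
    simp only [perturbedPosition, position_append_singleton] at this ⊢
    linarith
  · rintro h v ⟨hv, hvt⟩
    obtain ⟨u, k, rfl⟩ : ∃ u k, v = u ++ [k] := by
      rcases List.eq_nil_or_concat v with rfl | ⟨u, k, h⟩
      · simp at hv
      · exact ⟨u, k, by simpa using h⟩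
    obtain ⟨hk, hu⟩ := (inTree_append_singleton _ _ _).1 hvt
    have := h k hk u ⟨by simpa using hv, hu⟩
    simp only [perturbedPosition, position_append_singleton] at this ⊢
    linarith

theorem measurableSet_inTree (v : List ℕ) :
    MeasurableSet {z : List ℕ → Offspring | InTree z v} := by
  induction v with
  | nil => simp [InTree]
  | cons k u ih =>
    refine ih.inter ?_
    have : Measurable fun z : List ℕ → Offspring => (z u).1 := by fun_prop
    exact measurableSet_lt measurable_const this

theorem measurable_position (v : List ℕ) :
    Measurable fun z : List ℕ → Offspring => position z v := by
  induction v with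
  | nil => exact measurable_const
  | cons k u ih =>
    have : Measurable fun z : List ℕ → Offspring => (z u).2 k := by fun_prop
    exact ih.add this

theorem measurableSet_below (θ : ℝ) (n : ℕ) :
    MeasurableSet {q : ℝ × (List ℕ → Mark) | q.2 ∈ below θ n q.1} := by
  simp only [below, generation, Set.mem_ofPred_eq]
  rw [Set.ofPred_forall]
  refine MeasurableSet.iInter fun v : List ℕ => ?_
  have hz : Measurable fun (q : ℝ × (List ℕ → Mark)) (u : List ℕ) => (q.2 u).1 := by fun_prop
  by_cases hv : v.length = n
  · simp only [hv, true_and]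
    refine MeasurableSet.imp (hz (measurableSet_inTree v)) ?_
    refine measurableSet_lt ?_ measurable_fst
    refine ((measurable_position v).comp hz).add (Measurable.const_mul ?_ _)
    have h1 : Measurable fun q : ℝ × (List ℕ → Mark) => (q.2 v).2.1 := by fun_prop
    have h2 : Measurable fun q : ℝ × (List ℕ → Mark) => (q.2 v).2.2 := by fun_prop
    exact (h1.div h2).log
  · simp [hv]

theorem measurableSet_below_right (θ : ℝ) (n : ℕ) (x : ℝ) : MeasurableSet (below θ n x) :=
  measurable_prodMk_left (measurableSet_below θ n)

variable (ρ : Measure Offspring) (κ : Measure (ℝ × ℝ))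
  [IsProbabilityMeasure ρ] [IsProbabilityMeasure κ]

/-- The probability that all perturbed positions in generation `n` are less than `x`. -/
noncomputable def rightmostCDF (θ : ℝ) (n : ℕ) (x : ℝ) : ℝ :=
  (Measure.infinitePi fun _ : List ℕ => ρ.prod κ).real (below θ n x)

theorem isSubCDF_rightmostCDF (θ : ℝ) (n : ℕ) : IsSubCDF (rightmostCDF ρ κ θ n) where
  mono _ _ h := measureReal_mono fun _ hw v hv => (hw v hv).trans_le h
  nonneg _ := measureReal_nonneg
  le_one _ := measureReal_le_one

/-- Given the reproduction of the root, the subtrees of its children are independent and each is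
distributed as the whole tree. -/
theorem infinitePi_below_succ (θ : ℝ) (n : ℕ) (x : ℝ) :
    (Measure.infinitePi fun _ : List ℕ => ρ.prod κ) (below θ (n + 1) x) =
      ∫⁻ z, ∏ k ∈ Finset.range z.1,
        (Measure.infinitePi fun _ : List ℕ => ρ.prod κ) (below θ n (x - z.2 k)) ∂ρ := by
  set Q := Measure.infinitePi fun _ : List ℕ => ρ.prod κ
  set S : Set (Mark × (ℕ → List ℕ → Mark)) :=
    {p | ∀ k, k < p.1.1.1 → p.2 k ∈ below θ n (x - p.1.1.2 k)} with hSdef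
  have hS : MeasurableSet S := by
    rw [hSdef, Set.ofPred_forall]
    refine MeasurableSet.iInter fun k => ?_
    have h1 : Measurable fun p : Mark × (ℕ → List ℕ → Mark) => p.1.1.1 := by fun_prop
    have h2 : Measurable fun p : Mark × (ℕ → List ℕ → Mark) => (x - p.1.1.2 k, p.2 k) := by
      fun_prop
    exact (measurableSet_lt measurable_const h1).imp (h2 (measurableSet_below θ n))
  have hsplit : Measurable fun w : List ℕ → Mark =>
      (w [], fun (k : ℕ) (u : List ℕ) => w (u ++ [k])) := by fun_prop
  have hpre : below θ (n + 1) x =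
      (fun w : List ℕ → Mark => (w [], fun (k : ℕ) (u : List ℕ) => w (u ++ [k]))) ⁻¹' S := by
    ext w; exact mem_below_succ
  rw [hpre, ← Measure.map_apply hsplit hS, map_infinitePi_root_subtrees, Measure.prod_apply hS]
  have hfib : ∀ a : Mark, (Measure.infinitePi fun _ : ℕ => Q) (Prod.mk a ⁻¹' S) =
      ∏ k ∈ Finset.range a.1.1, Q (below θ n (x - a.1.2 k)) := by
    intro a
    rw [← Measure.infinitePi_pi (fun _ : ℕ => Q) fun k _ => measurableSet_below_right θ n _]
    congr 1
    ext p
    simp [hSdef, Set.mem_pi]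
  rw [lintegral_congr hfib]
  have hmeas : Measurable fun z : Offspring =>
      ∏ k ∈ Finset.range z.1, Q (below θ n (x - z.2 k)) := by
    refine measurable_from_prod_countable_right fun N => ?_
    refine Finset.measurable_prod (Finset.range N) fun k _ => ?_
    have hm : Measurable fun y : ℝ => Q (below θ n y) :=
      Monotone.measurable fun _ _ h => measure_mono fun _ hw v hv => (hw v hv).trans_le h
    exact hm.comp (measurable_const.sub (measurable_pi_apply k))
  exact (measurePreserving_fst (μ := ρ) (ν := κ)).lintegral_comp hmeas

theorem rightmostCDF_succ (θ : ℝ) (n : ℕ) :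
    rightmostCDF ρ κ θ (n + 1) = branch ρ (rightmostCDF ρ κ θ n) := by
  ext x
  have hcdf := isSubCDF_rightmostCDF ρ κ θ n
  rw [rightmostCDF, measureReal_def, infinitePi_below_succ, branch,
    integral_eq_lintegral_of_nonneg_ae (.of_forall (hcdf.prod_nonneg x))
      (hcdf.measurable_prod x).aestronglyMeasurable]
  congr 1
  refine lintegral_congr fun z => ?_
  rw [ENNReal.ofReal_prod_of_nonneg fun _ _ => hcdf.nonneg _]
  refine Finset.prod_congr rfl fun k _ => ?_
  rw [rightmostCDF, ofReal_measureReal]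

theorem rightmostCDF_eq_iterate (θ : ℝ) (n : ℕ) :
    rightmostCDF ρ κ θ n = (branch ρ)^[n] (rightmostCDF ρ κ θ 0) := by
  induction n with
  | zero => rfl
  | succ n ih => rw [rightmostCDF_succ, ih, Function.iterate_succ_apply']

theorem rightmostCDF_zero (θ x : ℝ) :
    rightmostCDF ρ κ θ 0 x = κ.real {p | 1 / θ * Real.log (p.1 / p.2) < x} := by
  have hm : MeasurableSet {p : ℝ × ℝ | 1 / θ * Real.log (p.1 / p.2) < x} := by
    refine measurableSet_lt (Measurable.const_mul ?_ _) measurable_const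
    exact (measurable_fst.div measurable_snd).log
  have hset : below θ 0 x = (fun w : List ℕ → Mark => w []) ⁻¹'
      (Prod.snd ⁻¹' {p | 1 / θ * Real.log (p.1 / p.2) < x}) := by
    ext w
    simp [below, generation, perturbedPosition, position, InTree, List.length_eq_zero_iff]
  rw [rightmostCDF, hset, measureReal_def, measureReal_def]
  congr 1
  have h1 := measurePreserving_eval_infinitePi (fun _ : List ℕ => ρ.prod κ) []
  have h2 := measurePreserving_snd (μ := ρ) (ν := κ)
  exact (h1.measure_preimage (h2.measurable hm).nullMeasurableSet).trans
    (h2.measure_preimage hm.nullMeasurableSet)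

end

/-! ### The perturbation -/

section

theorem expMeasure_one_Iic {c : ℝ} (hc : 0 ≤ c) :
    expMeasure 1 (Set.Iic c) = ENNReal.ofReal (1 - Real.exp (-c)) := by
  have := isProbabilityMeasure_expMeasure one_pos
  rw [← ofReal_cdf, cdf_expMeasure_eq one_pos, if_pos hc, one_mul]

theorem le_perturbation_iff {θ x y e : ℝ} (hθ : 0 < θ) (hy : 0 < y) (he : 0 < e) :
    x ≤ 1 / θ * Real.log (y / e) ↔ e ≤ y * Real.exp (-(θ * x)) := by
  rw [one_div, inv_mul_eq_div, le_div_iff₀ hθ, Real.le_log_iff_exp_le (div_pos hy he),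
    le_div_iff₀ he, Real.exp_neg, ← div_eq_mul_inv, le_div_iff₀ (Real.exp_pos _), mul_comm x θ,
    mul_comm e]

theorem one_sub_exp_neg_le_rpow {c r : ℝ} (hc : 0 < c) (hr0 : 0 ≤ r) (hr1 : r ≤ 1) :
    1 - Real.exp (-c) ≤ c ^ r := by
  rcases le_total c 1 with h | h
  · have h1 := Real.rpow_le_rpow_of_exponent_ge hc h hr1
    rw [Real.rpow_one] at h1
    linarith [Real.add_one_le_exp (-c)]
  · linarith [Real.one_le_rpow h hr0, Real.exp_pos (-c)]

variable {ρ : Measure Offspring} [IsProbabilityMeasure ρ] {μ : Measure ℝ} [IsProbabilityMeasure μ]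

instance : IsProbabilityMeasure (expMeasure 1) := isProbabilityMeasure_expMeasure one_pos

theorem one_sub_rightmostCDF_zero (hμ : μ (Set.Iic 0) = 0) {θ : ℝ} (hθ : 0 < θ) (x : ℝ) :
    Integrable (fun y : ℝ => 1 - Real.exp (-(y * Real.exp (-(θ * x))))) μ ∧
    1 - rightmostCDF ρ (μ.prod (expMeasure 1)) θ 0 x =
      ∫ y, (1 - Real.exp (-(y * Real.exp (-(θ * x))))) ∂μ := by
  have hμ' : ∀ᵐ y ∂μ, 0 < y := by rw [ae_iff]; simpa [Set.Iic_def] using hμ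
  have hE : ∀ᵐ e ∂expMeasure 1, 0 < e := by
    have := expMeasure_one_Iic le_rfl
    rw [ae_iff]; simpa [Set.Iic_def] using this
  have hmeas : Measurable fun y : ℝ => 1 - Real.exp (-(y * Real.exp (-(θ * x)))) := by fun_prop
  have hnn : ∀ᵐ y ∂μ, 0 ≤ 1 - Real.exp (-(y * Real.exp (-(θ * x)))) := by
    filter_upwards [hμ'] with y hy
    rw [sub_nonneg, Real.exp_le_one_iff, neg_nonpos]
    positivity
  refine ⟨Integrable.of_bound hmeas.aestronglyMeasurable 1 ?_, ?_⟩
  · filter_upwards [hnn] with y hy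
    rw [Real.norm_of_nonneg hy]
    linarith [Real.exp_pos (-(y * Real.exp (-(θ * x))))]
  have hS : MeasurableSet {p : ℝ × ℝ | 1 / θ * Real.log (p.1 / p.2) < x} := by
    refine measurableSet_lt (Measurable.const_mul ?_ _) measurable_const
    exact (measurable_fst.div measurable_snd).log
  rw [rightmostCDF_zero, ← probReal_compl_eq_one_sub hS, measureReal_def,
    Measure.prod_apply hS.compl, integral_eq_lintegral_of_nonneg_ae hnn hmeas.aestronglyMeasurable]
  congr 1
  refine lintegral_congr_ae ?_
  filter_upwards [hμ'] with y hy
  rw [← expMeasure_one_Iic (by positivity)]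
  refine measure_congr ?_
  filter_upwards [hE] with e he
  refine propext ?_
  change ¬ (1 / θ * Real.log (y / e) < x) ↔ e ≤ _
  rw [not_lt, le_perturbation_iff hθ hy he]

theorem rightmostCDF_zero_lt_one (hμ : μ (Set.Iic 0) = 0) {θ : ℝ} (hθ : 0 < θ) (x : ℝ) :
    rightmostCDF ρ (μ.prod (expMeasure 1)) θ 0 x < 1 := by
  obtain ⟨hi, he⟩ := one_sub_rightmostCDF_zero (ρ := ρ) hμ hθ x
  have hμ' : ∀ᵐ y ∂μ, 0 < y := by rw [ae_iff]; simpa [Set.Iic_def] using hμ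
  have hpos : ∀ᵐ y ∂μ, 0 < 1 - Real.exp (-(y * Real.exp (-(θ * x)))) := by
    filter_upwards [hμ'] with y hy
    rw [sub_pos, Real.exp_lt_one_iff, neg_lt_zero]
    positivity
  have hnn : 0 ≤ᵐ[μ] fun y => 1 - Real.exp (-(y * Real.exp (-(θ * x)))) :=
    hpos.mono fun _ h => h.le
  have h0 := integral_nonneg_of_ae hnn
  rcases h0.lt_or_eq with h | h
  · linarith
  · obtain ⟨y, h1, h2⟩ := (hpos.and ((integral_eq_zero_iff_of_nonneg_ae hnn hi).1 h.symm)).exists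
    exact absurd h2 h1.ne'

/-- The tail of the perturbation. Given `Y = y`, the perturbation exceeds `x` with probability
`1 - e^{-c}`, where `c = y e^{-θ x}`, and `1 - e^{-c} ≤ c^r` for every `r ∈ [0, 1]`. -/
theorem one_sub_rightmostCDF_zero_le (hμ : μ (Set.Iic 0) = 0) {θ t : ℝ} (hθ : 0 < θ) (ht : 0 < t)
    (htθ : t ≤ θ) (hint : Integrable (fun y : ℝ => y ^ (t / θ)) μ) (x : ℝ) :
    1 - rightmostCDF ρ (μ.prod (expMeasure 1)) θ 0 x ≤
      (∫ y, y ^ (t / θ) ∂μ) * Real.exp (-t * x) := by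
  obtain ⟨hi, he⟩ := one_sub_rightmostCDF_zero (ρ := ρ) hμ hθ x
  have hμ' : ∀ᵐ y ∂μ, 0 < y := by rw [ae_iff]; simpa [Set.Iic_def] using hμ
  rw [he, ← integral_mul_const]
  refine integral_mono_ae hi (hint.mul_const _) ?_
  filter_upwards [hμ'] with y hy
  refine (one_sub_exp_neg_le_rpow (by positivity) (by positivity)
    ((div_le_one hθ).2 htθ)).trans (le_of_eq ?_)
  rw [Real.mul_rpow hy.le (Real.exp_pos _).le, ← Real.exp_mul]
  congr 2
  field_simp

end

/-! ### Almost sure convergence -/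

theorem finite_generation (z : List ℕ → Offspring) (n : ℕ) : (generation z n).Finite := by
  induction n with
  | zero =>
    refine (Set.finite_singleton []).subset fun v hv => ?_
    simpa using List.length_eq_zero_iff.1 hv.1
  | succ n ih =>
    refine (ih.biUnion fun u _ => (Set.finite_Iio (z u).1).image fun k => k :: u).subset ?_
    rintro (_ | ⟨k, u⟩) ⟨hv, hvt⟩
    · simp at hv
    · simp only [Set.mem_iUnion]
      exact ⟨u, ⟨by simpa using hv, hvt.1⟩, k, hvt.2, rfl⟩

theorem generation_nonempty {z : List ℕ → Offspring} (hz : ∀ u, 1 ≤ (z u).1) (n : ℕ) :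
    (generation z n).Nonempty := by
  induction n with
  | zero => exact ⟨[], rfl, trivial⟩
  | succ n ih =>
    obtain ⟨u, hu, hut⟩ := ih
    exact ⟨0 :: u, by simp [hu], hut, hz u⟩

theorem rightmost_lt_iff {θ x : ℝ} {z : List ℕ → Offspring} {y e : List ℕ → ℝ}
    (hz : ∀ u, 1 ≤ (z u).1) (n : ℕ) :
    rightmost θ z y e n < x ↔ (fun u => (z u, (y u, e u))) ∈ below θ n x := by
  rw [rightmost, ((finite_generation z n).image _).csSup_lt_iff
    ((generation_nonempty hz n).image _)]
  simp [below]

/-- The marks of the labels are independent with the common law `ρ ⊗ μ ⊗ Exp(1)`. -/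
theorem IsInput.map_marks {Ω : Type*} [MeasurableSpace Ω] {P : Measure Ω} [IsProbabilityMeasure P]
    {ρ : Measure Offspring} {μ : Measure ℝ} {Z : List ℕ → Ω → Offspring} {Y E : List ℕ → Ω → ℝ}
    (h : IsInput P ρ μ Z Y E) :
    P.map (fun ω u => (Z u ω, (Y u ω, E u ω))) =
      Measure.infinitePi fun _ : List ℕ => ρ.prod (μ.prod (expMeasure 1)) := by
  have mYE : ∀ u, Measurable fun ω => (Y u ω, E u ω) := fun u =>
    (h.measurable_Y u).prodMk (h.measurable_E u)
  have hYE : iIndepFun (fun u ω => (Y u ω, E u ω)) P :=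
    iIndepFun_prodMk h.measurable_Y h.measurable_E h.indep_Y h.indep_E h.indep_Y_E
  have hZYE : IndepFun (fun ω u => Z u ω) (fun ω u => (Y u ω, E u ω)) P :=
    h.indep_Z_YE.comp (φ := id)
      (ψ := fun p : (List ℕ → ℝ) × (List ℕ → ℝ) => fun u => (p.1 u, p.2 u)) measurable_id
      (by fun_prop)
  have hall := iIndepFun_prodMk h.measurable_Z mYE h.indep_Z hYE hZYE
  rw [hall.map_fun_eq_infinitePi_map fun u => (h.measurable_Z u).prodMk (mYE u)]
  congr 1
  ext1 u
  rw [(indepFun_iff_map_prod_eq_prod_map_map (h.measurable_Z u).aemeasurable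
      (mYE u).aemeasurable).1 (hZYE.comp (measurable_pi_apply u) (measurable_pi_apply u)),
    (indepFun_iff_map_prod_eq_prod_map_map (h.measurable_Y u).aemeasurable
      (h.measurable_E u).aemeasurable).1
      (h.indep_Y_E.comp (measurable_pi_apply u) (measurable_pi_apply u)),
    h.law_Z, h.law_Y, h.law_E]

theorem IsInput.ae_one_le {Ω : Type*} [MeasurableSpace Ω] {P : Measure Ω}
    {ρ : Measure Offspring} {μ : Measure ℝ} {Z : List ℕ → Ω → Offspring} {Y E : List ℕ → Ω → ℝ}
    (h : IsInput P ρ μ Z Y E) (hsurv : ρ {z | z.1 = 0} = 0) :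
    ∀ᵐ ω ∂P, ∀ u, 1 ≤ (Z u ω).1 := by
  rw [ae_all_iff]
  intro u
  have := ae_one_le_offspring hsurv
  rw [← h.law_Z u] at this
  exact ae_of_ae_map (h.measurable_Z u).aemeasurable this

theorem tendsto_div_of_forall_rat {R : ℕ → ℝ} {v : ℝ}
    (hu : ∀ q : ℚ, v < q → ∀ᶠ n : ℕ in atTop, R n < n * q)
    (hl : ∀ q : ℚ, (q : ℝ) < v → ∀ᶠ n : ℕ in atTop, n * q ≤ R n) :
    Tendsto (fun n : ℕ => R n / n) atTop (𝓝 v) := by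
  rw [tendsto_order]
  constructor
  · intro a ha
    obtain ⟨q, hq1, hq2⟩ := exists_rat_btwn ha
    filter_upwards [hl q hq2, eventually_gt_atTop 0] with n hn hn0
    have : (0 : ℝ) < n := by exact_mod_cast hn0
    refine hq1.trans_le ?_
    rw [le_div_iff₀ this]; linarith
  · intro a ha
    obtain ⟨q, hq1, hq2⟩ := exists_rat_btwn ha
    filter_upwards [hu q hq1, eventually_gt_atTop 0] with n hn hn0
    have : (0 : ℝ) < n := by exact_mod_cast hn0
    refine lt_trans ?_ hq2
    rw [div_lt_iff₀ this]; linarith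

end PerturbedBRW

theorem mainTheorem5 {Ω : Type*} [MeasurableSpace Ω] (P : Measure Ω) [IsProbabilityMeasure P]
    (ρ : Measure PerturbedBRW.Offspring) [IsProbabilityMeasure ρ]
    (μ : Measure ℝ) [IsProbabilityMeasure μ]
    (Z : List ℕ → Ω → PerturbedBRW.Offspring) (Y E : List ℕ → Ω → ℝ)
    (hinput : PerturbedBRW.IsInput P ρ μ Z Y E)
    (hμ_pos : μ (Set.Iic 0) = 0)
    (hsurvival : ρ {z | z.1 = 0} = 0)
    (hν_finite : ∃ a b : ℝ, a < 0 ∧ 0 < b ∧ ∀ t ∈ Set.Ioo a b, PerturbedBRW.LaplaceFinite ρ t)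
    (θ₀ : ℝ) (hθ₀ : PerturbedBRW.criticalParam ρ = (θ₀ : EReal)) (hθ₀_pos : 0 < θ₀)
    (θ : ℝ) (hθ : θ₀ ≤ θ)
    (hmoments : ∀ r : ℝ, 0 < r → r < θ₀ / θ → Integrable (fun y : ℝ => y ^ r) μ) :
    ∀ᵐ ω ∂P, Tendsto
      (fun n : ℕ => PerturbedBRW.rightmost θ (fun u => Z u ω) (fun v => Y v ω)
        (fun v => E v ω) n / (n : ℝ))
      atTop (𝓝 (PerturbedBRW.nu ρ θ₀ / θ₀)) := by
  open PerturbedBRW in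
  have hθ_pos : 0 < θ := hθ₀_pos.trans_le hθ
  set κ := μ.prod (expMeasure 1)
  set W : Ω → List ℕ → Mark := fun ω u => (Z u ω, (Y u ω, E u ω)) with hW
  have mW : Measurable W := measurable_pi_iff.2 fun u =>
    (hinput.measurable_Z u).prodMk ((hinput.measurable_Y u).prodMk (hinput.measurable_E u))
  have hlaw : ∀ n x, P.real (W ⁻¹' below θ n x) = (branch ρ)^[n] (rightmostCDF ρ κ θ 0) x := by
    intro n x
    rw [← rightmostCDF_eq_iterate, rightmostCDF, ← hinput.map_marks,
      map_measureReal_apply mW (measurableSet_below_right θ n x)]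
  obtain ⟨hup, hlow⟩ := (isSubCDF_rightmostCDF ρ κ θ 0).summable_deviations hsurvival hν_finite
    hθ₀ hθ₀_pos (rightmostCDF_zero_lt_one hμ_pos hθ_pos) fun t ht htθ₀ =>
      ⟨_, one_sub_rightmostCDF_zero_le hμ_pos hθ_pos ht (htθ₀.le.trans hθ)
        (hmoments _ (div_pos ht hθ_pos) (div_lt_div_of_pos_right htθ₀ hθ_pos))⟩
  have hup' : ∀ᵐ ω ∂P, ∀ q : ℚ, nu ρ θ₀ / θ₀ < q →
      ∀ᶠ n : ℕ in atTop, W ω ∈ below θ n (n * q) := by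
    refine ae_all_iff.2 fun q => ?_
    by_cases hq : nu ρ θ₀ / θ₀ < q
    · have hfin : ∑' n : ℕ, P (W ⁻¹' below θ n (n * q))ᶜ ≠ ⊤ := by
        refine (tsum_congr fun n => ?_).trans_ne (hup q hq).tsum_ofReal_ne_top
        rw [← hlaw, ← probReal_compl_eq_one_sub (mW (measurableSet_below_right θ n _)),
          ofReal_measureReal]
      filter_upwards [ae_eventually_notMem hfin] with ω hω _
      exact hω.mono fun n hn => not_not.1 hn
    · exact .of_forall fun ω h => absurd h hq
  have hlow' : ∀ᵐ ω ∂P, ∀ q : ℚ, (q : ℝ) < nu ρ θ₀ / θ₀ →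
      ∀ᶠ n : ℕ in atTop, W ω ∉ below θ n (n * q) := by
    refine ae_all_iff.2 fun q => ?_
    by_cases hq : (q : ℝ) < nu ρ θ₀ / θ₀
    · have hfin : ∑' n : ℕ, P (W ⁻¹' below θ n (n * q)) ≠ ⊤ := by
        refine (tsum_congr fun n => ?_).trans_ne (hlow q hq).tsum_ofReal_ne_top
        rw [← hlaw, ofReal_measureReal]
      filter_upwards [ae_eventually_notMem hfin] with ω hω _
      exact hω
    · exact .of_forall fun ω h => absurd h hq
  filter_upwards [hup', hlow', hinput.ae_one_le hsurvival] with ω h1 h2 h3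
  refine tendsto_div_of_forall_rat (fun q hq => ?_) fun q hq => ?_
  · exact (h1 q hq).mono fun n hn => (rightmost_lt_iff h3 n).2 hn
  · exact (h2 q hq).mono fun n hn => not_lt.1 fun h => hn ((rightmost_lt_iff h3 n).1 h)
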